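/- Let $d,k\ge 0$ be integers. A $k$-current on $\mathbb{R}^d$ is a continuous linear functional on the space $\mathcal{D}^k(\mathbb{R}^d)$ of smooth compactly supported differential $k$-forms; its boundary is $\partial T(\omega)=T(d\omega)$ (with $\partial T=0$ if $k=0$), its mass $\mathbf{M}(T)$ is the supremum of $T(\omega)$ over all $\omega\in\mathcal{D}^k(\mathbb{R}^d)$ whose comass is at most $1$ at every point, and $T$ is normal if $\mathbf{M}(T)+\mathbf{M}(\partial T)<\infty$ and $\operatorname{supp}T$ is compact. For a compact set $K\subset\mathbb{R}^d$ let $\mathrm{N}_k(K)$ be the space of normal $k$-currents with support in $K$, and $\mathrm{B}_k(K)=\{\partial Z: Z\in\mathrm{N}_{k+1}(K)\}$. The set $K$ is a Lipschitz neighbourhood retract if there are a bounded neighbourhood $U$ of $K$ and a Lipschitz map $r:U\to K$ with $r(x)=x$ for all $x\in K$. **Normal Connectivity Theorem.** Let $K\subset\mathbb{R}^d$ be a compact Lipschitz neighbourhood retract and let $M>0$. Let $(T_j)_j\subset\mathrm{N}_k(K)$ be a sequence with $\partial T_j=0$ and $\mathbf{M}(T_j)\le M$ for all $j\in\mathbb{N}$,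 and let $T\in\mathrm{N}_k(K)$ be such that $T_j\rightharpoonup^* T$, that is, $T_j(\omega)\to T(\omega)$ for every $\omega\in\mathcal{D}^k(\mathbb{R}^d)$. Suppose that $T-T_j\in\mathrm{B}_k(K)$ for all sufficiently large $j$. Then there is a sequence $(R_j)_j\subset\mathrm{N}_{k+1}(K)$ such that $T-T_j=\partial R_j$ for all sufficiently large $j$, and $\mathbf{M}(R_j)\to 0$ as $j\to\infty$. -/

import Mathlib

open Filter Topology TopologicalSpace
open scoped ENNReal NNReal

noncomputable section

/-- The space `ℝ^d` with its Euclidean structure. -/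
abbrev Euc (d : ℕ) : Type := EuclideanSpace ℝ (Fin d)

/-- Continuous alternating `k`-linear forms on `ℝ^d`, i.e. `k`-covectors. The norm carried by this
space is the operator norm `sup |η (v₁, …, v_k)|` over `‖vᵢ‖ ≤ 1`. It is the comass norm, the
supremum of `η` over unit simple `k`-vectors: see `Covector.norm_le_iff_orthonormal`. -/
abbrev Covector (d k : ℕ) : Type := Euc d [⋀^Fin k]→L[ℝ] ℝ

/-- Hadamard's inequality for forms: a bound on orthonormal tuples (every unit simple `k`-vector is
`v₁ ∧ ⋯ ∧ v_k` for an orthonormal tuple) is a bound on all tuples. -/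
theorem Covector.abs_apply_le_of_orthonormal {d k : ℕ} (η : Covector d k) {c : ℝ} (hc : 0 ≤ c)
    (h : ∀ v : Fin k → Euc d, Orthonormal ℝ v → |η v| ≤ c) (v : Fin k → Euc d) :
    |η v| ≤ c * ∏ i, ‖v i‖ := by
  by_cases hv : LinearIndependent ℝ v
  · have hdim : Module.finrank ℝ (Submodule.span ℝ (Set.range v)) = k := by
      simpa using finrank_span_eq_card hv
    set W := Submodule.span ℝ (Set.range v) with hW
    have : Fact (Module.finrank ℝ W = k) := ⟨hdim⟩
    let b : OrthonormalBasis (Fin k) ℝ W :=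
      (stdOrthonormalBasis ℝ W).reindex (finCongr hdim)
    let w : Fin k → W := fun i => ⟨v i, Submodule.subset_span ⟨i, rfl⟩⟩
    let f : W [⋀^Fin k]→ₗ[ℝ] ℝ := η.toAlternatingMap.compLinearMap W.subtype
    have hf : f w = f b.toBasis * b.toBasis.det w := by
      conv_lhs => rw [f.eq_smul_basis_det b.toBasis]
      simp
    have h1 : |f b.toBasis| ≤ c := by
      have := h (fun i => (b i : Euc d)) (b.orthonormal.comp_linearIsometry W.subtypeₗᵢ)
      simpa [f, Function.comp_def] using this
    have h2 : |b.toBasis.det w| ≤ ∏ i, ‖v i‖ := by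
      have := (b.toBasis.orientation).abs_volumeForm_apply_le w
      rw [(b.toBasis.orientation).volumeForm_robust' b w] at this
      simpa [w] using this
    have h3 : η v = f w := rfl
    rw [h3, hf, abs_mul]
    exact mul_le_mul h1 h2 (abs_nonneg _) hc
  · have : η v = 0 := η.toAlternatingMap.map_linearDependent v hv
    rw [this, abs_zero]
    positivity

/-- The operator norm on `k`-covectors is the comass norm. -/
theorem Covector.norm_le_iff_orthonormal {d k : ℕ} (η : Covector d k) {c : ℝ} (hc : 0 ≤ c) :
    ‖η‖ ≤ c ↔ ∀ v : Fin k → Euc d, Orthonormal ℝ v → |η v| ≤ c := by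
  constructor
  · intro h v hv
    have := η.le_opNorm v
    simp only [hv.norm_eq_one, Finset.prod_const_one, mul_one, Real.norm_eq_abs] at this
    exact this.trans h
  · intro h
    exact η.opNorm_le_bound hc fun v => η.abs_apply_le_of_orthonormal hc h v

/-- `𝒟^k(ℝ^d)`: smooth compactly supported differential `k`-forms on `ℝ^d`, with the usual
(LF) topology. -/
abbrev TestForm (d k : ℕ) : Type := TestFunction (⊤ : Opens (Euc d)) (Covector d k) (⊤ : ℕ∞)

/-- `𝒟_k(ℝ^d)`: the `k`-currents on `ℝ^d`, i.e. the continuous linear functionals on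
`𝒟^k(ℝ^d)`. -/
abbrev Current (d k : ℕ) : Type := TestForm d k →L[ℝ] ℝ

/-- The exterior derivative of test forms, as a continuous linear map. -/
def TestForm.extDerivCLM (d k : ℕ) : TestForm d k →L[ℝ] TestForm d (k + 1) :=
  (TestFunction.postcompCLM (ContinuousAlternatingMap.alternatizeUncurryFinCLM ℝ (Euc d) ℝ)) ∘L
    (TestFunction.fderivCLM ℝ (⊤ : ℕ∞) (⊤ : ℕ∞))

/-- `TestForm.extDerivCLM` is pointwise the exterior derivative. -/
theorem TestForm.extDerivCLM_apply {d k : ℕ} (ω : TestForm d k) (x : Euc d) :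
    TestForm.extDerivCLM d k ω x = extDeriv ω x := by
  simp [TestForm.extDerivCLM, extDeriv]

namespace Current

/-- The boundary `∂T (ω) = T (dω)` of a `(k+1)`-current. -/
def boundary {d k : ℕ} (T : Current d (k + 1)) : Current d k :=
  T ∘L TestForm.extDerivCLM d k

/-- `∂T = 0`, where, as usual, the boundary of a `0`-current is zero. -/
def IsBoundaryless {d : ℕ} : {k : ℕ} → Current d k → Prop
  | 0, _ => True
  | _ + 1, T => boundary T = 0

/-- The mass `M(T)`: the supremum of `T (ω)` over test forms whose comass is everywhere at
most `1`. -/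
def mass {d k : ℕ} (T : Current d k) : ℝ≥0∞ :=
  ⨆ (ω : TestForm d k) (_ : ∀ x, ‖ω x‖ ≤ 1), ENNReal.ofReal (T ω)

/-- The mass `M(∂T)` of the boundary, which is zero for a `0`-current. -/
def boundaryMass {d : ℕ} : {k : ℕ} → Current d k → ℝ≥0∞
  | 0, _ => 0
  | _ + 1, T => mass (boundary T)

/-- The support of a current: the complement of the largest open set `U` such that `T (ω) = 0`
for all test forms `ω` with support in `U`. -/
def support {d k : ℕ} (T : Current d k) : Set (Euc d) := Distribution.dsupport T

/-- A normal current: `M(T) + M(∂T) < ∞` and the support is compact. -/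
def IsNormal {d k : ℕ} (T : Current d k) : Prop :=
  mass T + boundaryMass T < ∞ ∧ IsCompact (support T)

/-- `N_k(K)`: the normal `k`-currents with support in `K`. -/
def normalIn {d : ℕ} (k : ℕ) (K : Set (Euc d)) : Set (Current d k) :=
  {T | IsNormal T ∧ support T ⊆ K}

/-- `B_k(K)`: the boundaries of normal `(k+1)`-currents with support in `K`. -/
def normalBoundaries {d : ℕ} (k : ℕ) (K : Set (Euc d)) : Set (Current d k) :=
  {T | ∃ Z ∈ normalIn (k + 1) K, T = boundary Z}

/-- Weak* convergence of a sequence of currents: convergence on every test form. -/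
def WeakStarTendsto {d k : ℕ} (T : ℕ → Current d k) (T' : Current d k) : Prop :=
  ∀ ω : TestForm d k, Tendsto (fun j => T j ω) atTop (𝓝 (T' ω))

end Current

/-- `K` is a Lipschitz neighbourhood retract: there is a Lipschitz retraction of a bounded
neighbourhood `U` of `K` onto `K`. -/
def IsLipschitzNhdRetract {d : ℕ} (K : Set (Euc d)) : Prop :=
  ∃ (U : Set (Euc d)) (r : Euc d → Euc d) (L : ℝ≥0),
    U ∈ 𝓝ˢ K ∧ Bornology.IsBounded U ∧ LipschitzOnWith L r U ∧ Set.MapsTo r U K ∧ Set.EqOn r id K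

end

/-!
A normal current `T` with support in `K` satisfies `|T ω| ≤ M(T) * sup_K ‖ω‖`, so by Hahn–Banach it
is the restriction to test forms of a functional (a `Chain`) on the Banach space `C(K, Λᵏ)`, of norm
at most `M(T)` (`Current.exists_chain`). Conversely a chain defines a current with support in `K`
and mass at most its norm (`Chain.toCurrent`). The theorem becomes a statement on chains: boundaries
`S_j` of bounded norm that tend to zero on test forms have fillings of norm tending to zero
(`IsSmoothRetraction.exists_fillings_tendsto_zero`). Only boundaries are ever deformed, so the
homotopy formula is needed only in the form `Q = ∂V`, where it follows from `d ∘ d = 0` and Cartan's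
formula (`Chain.HasBoundary.homotopy`).

**Smoothing.** Let `φ` be a mollifier of radius `ε`, and `ρ_n` smooth maps with a common Lipschitz
constant `L` that approximate the retraction uniformly. To a chain `S` one associates the functional
`ω ↦ S (φ * ρ_n^* ω)`, which averages over translations and pushes forward back to `K`. As `n → ∞`
(along an ultrafilter, as the derivatives of `ρ_n` need not converge) one obtains a chain `A` in
`K`. Two facts make this useful.

* The averages `φ * Ω`, restricted to `K`, of the forms `Ω` bounded by a constant near `K` are a
  totally bounded subset of `C(K, Λᵏ)`, by Arzelà–Ascoli (`totallyBounded_averageK`). Therefore weak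
  convergence of a bounded sequence is uniform on averages (`eventually_isSmallOnAverages`), and the
  smoothed chains tend to zero in norm (`IsSmoothRetraction.exists_average_limit`).
* If `S` is a boundary, then `A - S = ∂G` with `‖G‖ ≤ ε L^(k+1) ‖S‖`, by the homotopy formula for
  translations (`IsSmoothRetraction.exists_decomposition`).

**Isoperimetric inequality.** Every boundary `Q` has a filling of norm at most `C ‖Q‖`
(`IsSmoothRetraction.exists_isoperimetric`). Otherwise there are almost minimal fillings `R_n` of
norm `1` of boundaries `Q_n → 0`. A weak-* limit `R` of the `R_n` is a cycle, so `R_n - R` fills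
`Q_n` as well and tends to zero weakly. The smoothing of `R_n - R`, corrected by a chain of norm at
most `ε L^(k+1) ‖Q_n‖`, also fills `Q_n`, and its norm tends to zero, contrary to minimality.

**Conclusion.** Given `δ`, choose `ε` so small that `S_j = A_j - ∂G_j` with `‖G_j‖ ≤ δ / 2`. For
large `j` the smoothed boundary `A_j` has so small a norm that the isoperimetric inequality fills it
with norm at most `δ / 2`.
-/

noncomputable section

open MeasureTheory

/-! ### Smooth forms: pullback, slices and Cartan's formula -/

section Forms

variable {E F : Type*} [NormedAddCommGroup E] [NormedSpace ℝ E] [NormedAddCommGroup F]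
  [NormedSpace ℝ F] {k : ℕ}

instance ContinuousMultilinearMap.finiteDimensional_real [FiniteDimensional ℝ E] :
    FiniteDimensional ℝ (ContinuousMultilinearMap ℝ (fun _ : Fin k => E) ℝ) :=
  Module.Finite.of_injective ContinuousMultilinearMap.toMultilinearMapLinear
    ContinuousMultilinearMap.toMultilinearMap_injective

instance ContinuousAlternatingMap.finiteDimensional_real [FiniteDimensional ℝ E] :
    FiniteDimensional ℝ (E [⋀^Fin k]→L[ℝ] ℝ) :=
  Module.Finite.of_injective
    (ContinuousAlternatingMap.toContinuousMultilinearMapLI (𝕜 := ℝ) (E := E) (F := ℝ)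
      (ι := Fin k)).toLinearMap
    ContinuousAlternatingMap.toContinuousMultilinearMap_injective

theorem ContDiff.continuousAlternatingMap_compContinuousLinearMap [FiniteDimensional ℝ E]
    {G : Type*} [NormedAddCommGroup G] [NormedSpace ℝ G] {n : WithTop ℕ∞}
    {f : G → F [⋀^Fin k]→L[ℝ] ℝ} {A : G → E →L[ℝ] F} (hf : ContDiff ℝ n f) (hA : ContDiff ℝ n A) :
    ContDiff ℝ n fun x => (f x).compContinuousLinearMap (A x) := by
  -- alternating maps form a direct summand of all multilinear maps, where the claim is known
  obtain ⟨P, hP⟩ := LinearMap.exists_leftInverse_of_injective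
    (ContinuousAlternatingMap.toContinuousMultilinearMapLI (𝕜 := ℝ) (E := E) (F := ℝ)
      (ι := Fin k)).toLinearMap
    (LinearMap.ker_eq_bot.2 ContinuousAlternatingMap.toContinuousMultilinearMap_injective)
  have h1 : ContDiff ℝ n fun x =>
      ContinuousMultilinearMap.compContinuousLinearMapContinuousMultilinear ℝ
        (fun _ : Fin k => E) (fun _ => F) ℝ (fun _ => A x) (f x).toContinuousMultilinearMap :=
    ((ContinuousMultilinearMap.contDiff _).comp (contDiff_pi.2 fun _ => hA)).clm_apply
      ((ContinuousAlternatingMap.toContinuousMultilinearMapLI (𝕜 := ℝ) (E := F) (F := ℝ)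
      (ι := Fin k)).contDiff.comp hf)
  have h2 := (LinearMap.toContinuousLinearMap P).contDiff (n := n) |>.comp h1
  convert h2 using 1
  ext1 x
  exact (LinearMap.congr_fun hP ((f x).compContinuousLinearMap (A x))).symm

theorem ContDiff.extDeriv {ω : E → E [⋀^Fin k]→L[ℝ] ℝ} (hω : ContDiff ℝ (⊤ : ℕ∞) ω) :
    ContDiff ℝ (⊤ : ℕ∞) (extDeriv ω) :=
  (ContinuousAlternatingMap.alternatizeUncurryFinCLM ℝ E ℝ).contDiff.comp
    (hω.fderiv_right (by simp))

/-- The pullback `g^*ω` of a differential form `ω` under the map `g`. -/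
def pullbackForm (g : E → F) (ω : F → F [⋀^Fin k]→L[ℝ] ℝ) : E → E [⋀^Fin k]→L[ℝ] ℝ :=
  fun x => (ω (g x)).compContinuousLinearMap (fderiv ℝ g x)

theorem ContDiff.pullbackForm [FiniteDimensional ℝ E] {g : E → F}
    {ω : F → F [⋀^Fin k]→L[ℝ] ℝ} (hg : ContDiff ℝ (⊤ : ℕ∞) g) (hω : ContDiff ℝ (⊤ : ℕ∞) ω) :
    ContDiff ℝ (⊤ : ℕ∞) (pullbackForm g ω) :=
  (hω.comp hg).continuousAlternatingMap_compContinuousLinearMap (hg.fderiv_right (by simp))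

theorem extDeriv_pullbackForm {g : E → F} {ω : F → F [⋀^Fin k]→L[ℝ] ℝ}
    (hg : ContDiff ℝ (⊤ : ℕ∞) g) (hω : ContDiff ℝ (⊤ : ℕ∞) ω) :
    _root_.extDeriv (_root_.pullbackForm g ω) = _root_.pullbackForm g (_root_.extDeriv ω) := by
  ext1 x
  refine extDeriv_pullback (r := (⊤ : ℕ∞)) (hω.differentiable (by simp) _) hg.contDiffAt ?_
  simp only [minSmoothness_of_isRCLikeNormedField]
  exact WithTop.coe_le_coe.2 (le_top : (2 : ℕ∞) ≤ ⊤)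

theorem extDeriv_extDeriv_of_smooth {ω : E → E [⋀^Fin k]→L[ℝ] ℝ} (hω : ContDiff ℝ (⊤ : ℕ∞) ω) :
    _root_.extDeriv (_root_.extDeriv ω) = 0 := by
  refine extDeriv_extDeriv hω ?_
  simp only [minSmoothness_of_isRCLikeNormedField]
  exact WithTop.coe_le_coe.2 (le_top : (2 : ℕ∞) ≤ ⊤)

theorem ContinuousAlternatingMap.norm_compContinuousLinearMap_le_pow (η : F [⋀^Fin k]→L[ℝ] ℝ)
    (A : E →L[ℝ] F) {L : ℝ} (hA : ‖A‖ ≤ L) :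
    ‖η.compContinuousLinearMap A‖ ≤ ‖η‖ * L ^ k := by
  refine (η.norm_compContinuousLinearMap_le A).trans ?_
  rw [Fintype.card_fin]
  gcongr

/-- The restriction to the slice `{t} × E` of a form on `ℝ × E`. -/
def sliceForm (Ω : ℝ × E → (ℝ × E) [⋀^Fin k]→L[ℝ] ℝ) (t : ℝ) : E → E [⋀^Fin k]→L[ℝ] ℝ :=
  fun x => (Ω (t, x)).compContinuousLinearMap (.inr ℝ ℝ E)

/-- The contraction of a form on `ℝ × E` with the unit vector field in the direction of `ℝ`,
restricted to the slice `{t} × E`. -/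
def sliceContract (Ω : ℝ × E → (ℝ × E) [⋀^Fin (k + 1)]→L[ℝ] ℝ) (t : ℝ) :
    E → E [⋀^Fin k]→L[ℝ] ℝ :=
  fun x => ((Ω (t, x)).curryLeft (1, 0)).compContinuousLinearMap (.inr ℝ ℝ E)

theorem contDiff_sliceForm [FiniteDimensional ℝ E] {Ω : ℝ × E → (ℝ × E) [⋀^Fin k]→L[ℝ] ℝ}
    (hΩ : ContDiff ℝ (⊤ : ℕ∞) Ω) : ContDiff ℝ (⊤ : ℕ∞) fun p : ℝ × E => sliceForm Ω p.1 p.2 :=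
  hΩ.continuousAlternatingMap_compContinuousLinearMap contDiff_const

theorem contDiff_sliceContract [FiniteDimensional ℝ E]
    {Ω : ℝ × E → (ℝ × E) [⋀^Fin (k + 1)]→L[ℝ] ℝ}
    (hΩ : ContDiff ℝ (⊤ : ℕ∞) Ω) : ContDiff ℝ (⊤ : ℕ∞) fun p : ℝ × E => sliceContract Ω p.1 p.2 :=
  ContDiff.continuousAlternatingMap_compContinuousLinearMap
    ((ContinuousAlternatingMap.curryLeftLI.contDiff.comp hΩ).clm_apply contDiff_const)
    contDiff_const

theorem contDiff_sliceForm_right [FiniteDimensional ℝ E]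
    {Ω : ℝ × E → (ℝ × E) [⋀^Fin k]→L[ℝ] ℝ} (hΩ : ContDiff ℝ (⊤ : ℕ∞) Ω) (t : ℝ) :
    ContDiff ℝ (⊤ : ℕ∞) (sliceForm Ω t) :=
  (contDiff_sliceForm hΩ).comp (contDiff_prodMk_right t)

theorem contDiff_sliceContract_right [FiniteDimensional ℝ E]
    {Ω : ℝ × E → (ℝ × E) [⋀^Fin (k + 1)]→L[ℝ] ℝ} (hΩ : ContDiff ℝ (⊤ : ℕ∞) Ω) (t : ℝ) :
    ContDiff ℝ (⊤ : ℕ∞) (sliceContract Ω t) := by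
  have h := ContDiff.comp (g := fun p : ℝ × E => sliceContract Ω p.1 p.2)
    (contDiff_sliceContract hΩ) (contDiff_prodMk_right (n := (⊤ : ℕ∞)) (𝕜 := ℝ) (F := E) t)
  exact h

theorem pullbackForm_slice {h : ℝ × E → F} (hh : ContDiff ℝ (⊤ : ℕ∞) h)
    (η : F → F [⋀^Fin k]→L[ℝ] ℝ) (t : ℝ) :
    pullbackForm (fun x => h (t, x)) η = sliceForm (pullbackForm h η) t := by
  ext x v
  have hx : HasFDerivAt (fun y : E => (t, y)) (ContinuousLinearMap.inr ℝ ℝ (E)) x := by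
    simpa using! (hasFDerivAt_const t x).prodMk (hasFDerivAt_id x)
  have h1 : HasFDerivAt (fun x => h (t, x)) (fderiv ℝ h (t, x) ∘L .inr ℝ ℝ (E)) x :=
    (hh.differentiable (by simp) (t, x)).hasFDerivAt.comp x hx
  simp [pullbackForm, sliceForm, h1.fderiv, Function.comp_def]

theorem contDiff_extDeriv_parametric {G : Type*} [NormedAddCommGroup G] [NormedSpace ℝ G]
    {η : G → E → E [⋀^Fin k]→L[ℝ] ℝ}
    (hη : ContDiff ℝ (⊤ : ℕ∞) fun p : G × E => η p.1 p.2) :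
    ContDiff ℝ (⊤ : ℕ∞) fun p : G × E => extDeriv (η p.1) p.2 := by
  have hg : ContDiff ℝ (⊤ : ℕ∞) fun q : (G × E) × E => (q.1.1, q.2) := by fun_prop
  have hu : ContDiff ℝ (⊤ : ℕ∞) (Function.uncurry fun (p : G × E) (x : E) => η p.1 x) :=
    hη.comp hg
  have hf : ContDiff ℝ (⊤ : ℕ∞) fun p : G × E => fderiv ℝ (η p.1) p.2 :=
    ContDiff.fderiv (m := (⊤ : ℕ∞)) hu contDiff_snd (by simp)
  let c := ContinuousAlternatingMap.alternatizeUncurryFinCLM ℝ E ℝ (n := k)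
  have hc : ContDiff ℝ (⊤ : ℕ∞) fun p : G × E => c (fderiv ℝ (η p.1) p.2) :=
    contDiff_const.clm_apply hf
  exact hc

theorem contDiff_extDeriv_sliceContract [FiniteDimensional ℝ E]
    {Ω : ℝ × E → (ℝ × E) [⋀^Fin (k + 1)]→L[ℝ] ℝ} (hΩ : ContDiff ℝ (⊤ : ℕ∞) Ω) :
    ContDiff ℝ (⊤ : ℕ∞) fun p : ℝ × E => extDeriv (sliceContract Ω p.1) p.2 :=
  contDiff_extDeriv_parametric (contDiff_sliceContract hΩ)

/-- Cartan's formula for the vector field `∂/∂t` on `ℝ × E`, for a closed form. -/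
theorem hasDerivAt_sliceForm [FiniteDimensional ℝ E]
    {Ω : ℝ × E → (ℝ × E) [⋀^Fin (k + 1)]→L[ℝ] ℝ}
    (hΩ : ContDiff ℝ (⊤ : ℕ∞) Ω) (hd : extDeriv Ω = 0) (t : ℝ) (x : E) :
    HasDerivAt (fun s => sliceForm Ω s x) (extDeriv (sliceContract Ω t) x) t := by
  have hdiff : DifferentiableAt ℝ Ω (t, x) := hΩ.differentiable (by simp) _
  have hline : HasDerivAt (fun s : ℝ => (s, x)) ((1 : ℝ), (0 : E)) t :=
    (hasDerivAt_id t).prodMk (hasDerivAt_const t x)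
  let C (m : ℕ) : (ℝ × E) [⋀^Fin m]→L[ℝ] ℝ →L[ℝ] E [⋀^Fin m]→L[ℝ] ℝ :=
    ContinuousAlternatingMap.compContinuousLinearMapCLM (ContinuousLinearMap.inr ℝ ℝ E)
  let D : (ℝ × E) [⋀^Fin (k + 1)]→L[ℝ] ℝ →L[ℝ] (ℝ × E) [⋀^Fin k]→L[ℝ] ℝ :=
    (ContinuousLinearMap.apply ℝ _ ((1 : ℝ), (0 : E))) ∘L
      (ContinuousAlternatingMap.curryLeftLI (𝕜 := ℝ) (E := ℝ × E) (F := ℝ)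
        (n := k)).toContinuousLinearMap
  have h1 : HasDerivAt (fun s => sliceForm Ω s x)
      ((fderiv ℝ Ω (t, x) (1, 0)).compContinuousLinearMap (.inr ℝ ℝ E)) t :=
    (C (k + 1)).hasFDerivAt.comp_hasDerivAt t (hdiff.hasFDerivAt.comp_hasDerivAt t hline)
  convert h1 using 1
  ext v
  have h0 : extDeriv Ω (t, x) (Matrix.vecCons (1, 0) fun i => ((0 : ℝ), v i)) = 0 := by
    rw [hd]; rfl
  rw [extDeriv, ContinuousAlternatingMap.alternatizeUncurryFin_apply, Fin.sum_univ_succ] at h0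
  rw [extDeriv, ContinuousAlternatingMap.alternatizeUncurryFin_apply]
  have h2 : ∀ (i : Fin (k + 1)), fderiv ℝ (sliceContract Ω t) x (v i) (i.removeNth v) =
      fderiv ℝ Ω (t, x) (0, v i)
        (Matrix.vecCons (1, 0) fun j => ((0 : ℝ), i.removeNth v j)) := by
    intro i
    have hx : HasFDerivAt (fun y : E => (t, y)) (ContinuousLinearMap.inr ℝ ℝ E) x := by
      simpa using! (hasFDerivAt_const t x).prodMk (hasFDerivAt_id x)
    have : HasFDerivAt (sliceContract Ω t)
        ((C k ∘L D) ∘L (fderiv ℝ Ω (t, x) ∘L .inr ℝ ℝ E)) x :=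
      (C k ∘L D).hasFDerivAt.comp x (hdiff.hasFDerivAt.comp x hx)
    rw [this.fderiv]
    simp [C, D, Function.comp_def]
  have h3 : ∀ i : Fin (k + 1),
      i.succ.removeNth (Matrix.vecCons ((1 : ℝ), (0 : E)) fun i => ((0 : ℝ), v i)) =
        Matrix.vecCons (1, 0) fun j => ((0 : ℝ), i.removeNth v j) := by
    intro i
    ext1 j
    refine Fin.cases ?_ (fun j => ?_) j <;> simp [Fin.removeNth]
  have h4 : Fin.removeNth 0 (Matrix.vecCons ((1 : ℝ), (0 : E)) fun i => ((0 : ℝ), v i)) =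
      fun i => ((0 : ℝ), v i) := by
    ext1 j
    simp [Fin.removeNth]
  simp only [h3, h4, h2, Matrix.cons_val_zero, Matrix.cons_val_succ, Fin.val_zero, pow_zero,
    one_smul, Fin.val_succ, pow_succ, mul_neg_one, neg_smul, Finset.sum_neg_distrib] at h0 ⊢
  exact (add_neg_eq_zero.1 h0).symm

end Forms

/-! ### Functionals on continuous forms and the homotopy formula -/

section Chains

variable {d k : ℕ} {K : Set (Euc d)} {F : Type*} [NormedAddCommGroup F]

/-- The restriction to `K` of a function on `ℝ^d`, as a bundled continuous map. The value for
functions that are not continuous on `K` is `0`. -/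
def resK (K : Set (Euc d)) (f : Euc d → F) : C(K, F) :=
  ContinuousMap.mkD (K.domRestrict f) 0

theorem resK_apply {f : Euc d → F} (hf : Continuous f) (x : K) : resK K f x = f x :=
  ContinuousMap.mkD_apply_of_continuous (hf.comp continuous_subtype_val)

theorem resK_add {f g : Euc d → F} (hf : Continuous f) (hg : Continuous g) :
    resK K (fun x => f x + g x) = resK K f + resK K g := by
  ext1 x
  rw [resK_apply (f := fun x => f x + g x) (hf.add hg)]
  simp [resK_apply, hf, hg]

theorem resK_smul [NormedSpace ℝ F] {f : Euc d → F} (c : ℝ) (hf : Continuous f) :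
    resK K (fun x => c • f x) = c • resK K f := by
  ext1 x
  rw [resK_apply (f := fun x => c • f x) (hf.const_smul c)]
  simp [resK_apply, hf]

theorem resK_congr {f g : Euc d → F} (h : ∀ x ∈ K, f x = g x) : resK K f = resK K g := by
  have : K.domRestrict f = K.domRestrict g := by
    ext1 x
    exact h x x.2
  rw [resK, this, resK]

theorem continuous_resK {Y : Type*} [TopologicalSpace Y] {f : Y → Euc d → F}
    (hf : Continuous (Function.uncurry f)) : Continuous fun y => resK K (f y) := by
  let G : C(Y × K, F) :=
    ⟨fun p => f p.1 p.2,
      hf.comp (continuous_fst.prodMk (continuous_subtype_val.comp continuous_snd))⟩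
  convert G.curry.continuous using 1
  ext y x
  exact resK_apply (hf.comp (Continuous.prodMk_right y)) x

variable [CompactSpace K]

theorem norm_resK_le {f : Euc d → F} (hf : Continuous f) {C : ℝ} (hC : 0 ≤ C)
    (h : ∀ x ∈ K, ‖f x‖ ≤ C) : ‖resK K f‖ ≤ C := by
  rw [ContinuousMap.norm_le _ hC]
  intro x
  rw [resK_apply hf]
  exact h x x.2

theorem norm_le_norm_resK {f : Euc d → F} (hf : Continuous f) {x : Euc d} (hx : x ∈ K) :
    ‖f x‖ ≤ ‖resK K f‖ := by
  rw [← resK_apply hf ⟨x, hx⟩]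
  exact ContinuousMap.norm_coe_le_norm _ _

theorem integral_resK_apply [NormedSpace ℝ F] [CompleteSpace F] {α : Type*} [MeasurableSpace α]
    {μ : Measure α} {f : α → C(K, F)} (hf : Integrable f μ) (x : K) :
    (∫ a, f a ∂μ) x = ∫ a, f a x ∂μ :=
  ((ContinuousMap.evalCLM ℝ x).integral_comp_comm hf).symm

/-- Continuous linear functionals on the space of continuous functions on `K` with values in the
normed space `F`. -/
abbrev DualC (K : Set (Euc d)) [CompactSpace K] (F : Type*) [NormedAddCommGroup F]
    [NormedSpace ℝ F] : Type _ :=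
  StrongDual ℝ C(K, F)

/-- Continuous linear functionals on the space of continuous `k`-covector fields on `K`. These
represent the `k`-currents of finite mass with support in `K`, and their norm is the mass. -/
abbrev Chain (K : Set (Euc d)) [CompactSpace K] (k : ℕ) : Type _ := DualC K (Covector d k)

/-- `V` has boundary `Q`, as currents: `V (dη) = Q (η)` for all smooth forms `η`. -/
def Chain.HasBoundary (V : Chain K (k + 1)) (Q : Chain K k) : Prop :=
  ∀ η : Euc d → Covector d k, ContDiff ℝ (⊤ : ℕ∞) η →
    V (resK K (extDeriv η)) = Q (resK K η)

/-- The fundamental theorem of calculus in `C(K, F)`, for a family that is differentiable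
pointwise. -/
theorem resK_sub_eq_integral [NormedSpace ℝ F] [CompleteSpace F] {f f' : ℝ → Euc d → F}
    (hf : ∀ t, Continuous (f t)) (hf' : Continuous fun p : ℝ × Euc d => f' p.1 p.2)
    (h : ∀ t x, HasDerivAt (fun s => f s x) (f' t x) t) :
    resK K (f 1) - resK K (f 0) = ∫ t in (0 : ℝ)..1, resK K (f' t) := by
  have hint : IntervalIntegrable (fun t => resK K (f' t)) volume 0 1 :=
    (continuous_resK hf').intervalIntegrable 0 1
  ext1 x
  have h1 := (ContinuousMap.evalCLM ℝ x).intervalIntegral_comp_comm hint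
  simp only [ContinuousMap.evalCLM_apply] at h1
  rw [← h1]
  have h2 : ∀ t, resK K (f' t) x = f' t x :=
    fun t => resK_apply (hf'.comp (Continuous.prodMk_right t)) x
  simp only [h2, resK_apply (hf _), ContinuousMap.sub_apply]
  exact (intervalIntegral.integral_eq_sub_of_hasDerivAt (f := fun t => f t x)
    (fun t _ => h t x)
    ((hf'.comp (Continuous.prodMk_left (x : Euc d))).intervalIntegrable 0 1)).symm

/-- The homotopy formula for a boundary `Q`, tested against a smooth form `η`. -/
theorem Chain.HasBoundary.homotopy {V : Chain K (k + 1)} {Q : Chain K k} (hVQ : V.HasBoundary Q)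
    {h : ℝ × Euc d → Euc d} (hh : ContDiff ℝ (⊤ : ℕ∞) h) {η : Euc d → Covector d k}
    (hη : ContDiff ℝ (⊤ : ℕ∞) η) :
    Q (resK K (pullbackForm (fun x => h (1, x)) η)) -
      Q (resK K (pullbackForm (fun x => h (0, x)) η)) =
    ∫ t in (0 : ℝ)..1, Q (resK K (sliceContract (pullbackForm h (extDeriv η)) t)) := by
  have hpt : ∀ t, ContDiff ℝ (⊤ : ℕ∞) fun x => h (t, x) := fun t =>
    hh.comp (contDiff_prodMk_right t)
  have hΩ : ContDiff ℝ (⊤ : ℕ∞) (pullbackForm h (extDeriv η)) := hh.pullbackForm hη.extDeriv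
  have hclosed : extDeriv (pullbackForm h (extDeriv η)) = 0 := by
    rw [extDeriv_pullbackForm hh hη.extDeriv, extDeriv_extDeriv_of_smooth hη]
    ext x v
    rfl
  have hV : ∀ t, Q (resK K (pullbackForm (fun x => h (t, x)) η)) =
      V (resK K (sliceForm (pullbackForm h (extDeriv η)) t)) := by
    intro t
    rw [← hVQ _ ((hpt t).pullbackForm hη), extDeriv_pullbackForm (hpt t) hη,
      pullbackForm_slice hh]
  generalize pullbackForm h (extDeriv η) = Ω at *
  have hc : Continuous fun p : ℝ × Euc d => extDeriv (sliceContract Ω p.1) p.2 :=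
    (contDiff_extDeriv_sliceContract hΩ).continuous
  have hint : IntervalIntegrable (fun t => resK K (extDeriv (sliceContract Ω t))) volume 0 1 :=
    (continuous_resK hc).intervalIntegrable 0 1
  have hkey := resK_sub_eq_integral (K := K) (f := sliceForm Ω)
    (f' := fun t => extDeriv (sliceContract Ω t))
    (fun t => (contDiff_sliceForm_right hΩ t).continuous) hc
    (hasDerivAt_sliceForm hΩ hclosed)
  rw [hV, hV, ← map_sub, hkey, ← V.intervalIntegral_comp_comm hint]
  exact intervalIntegral.integral_congr fun t _ => hVQ _ (contDiff_sliceContract_right hΩ t)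

end Chains

/-! ### Averaging over translations -/

section Averaging

variable {d k : ℕ} {K : Set (Euc d)} {F : Type*} [NormedAddCommGroup F]

/-- A continuous probability density on `ℝ^d` supported in the closed ball of radius `ε`. -/
structure IsMollifier (φ : Euc d → ℝ) (ε : ℝ) : Prop where
  continuous : Continuous φ
  eq_zero : ∀ y, ε < ‖y‖ → φ y = 0
  nonneg : ∀ y, 0 ≤ φ y
  integral_eq_one : ∫ y, φ y = 1

theorem exists_contDiff_isMollifier (d : ℕ) {ε : ℝ} (hε : 0 < ε) :
    ∃ φ : Euc d → ℝ, ContDiff ℝ (⊤ : ℕ∞) φ ∧ IsMollifier φ ε := by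
  let b : ContDiffBump (0 : Euc d) := ⟨ε / 2, ε, half_pos hε, half_lt_self hε⟩
  refine ⟨b.normed volume, b.contDiff_normed, b.continuous_normed, fun y hy => ?_,
    b.nonneg_normed, b.integral_normed⟩
  have : y ∉ Function.support (b.normed volume) := by
    rw [b.support_normed_eq]
    simpa using! hy.le
  exact Function.notMem_support.1 this

variable {φ : Euc d → ℝ} {ε : ℝ}

theorem IsMollifier.hasCompactSupport (hφ : IsMollifier φ ε) : HasCompactSupport φ :=
  HasCompactSupport.intro (isCompact_closedBall (0 : Euc d) ε) fun y hy =>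
    hφ.eq_zero y (by simpa using hy)

theorem IsMollifier.integrable (hφ : IsMollifier φ ε) : Integrable φ :=
  hφ.continuous.integrable_of_hasCompactSupport hφ.hasCompactSupport

theorem IsMollifier.integrable_smul [NormedSpace ℝ F] (hφ : IsMollifier φ ε) {f : Euc d → F}
    (hf : Continuous f) : Integrable fun y => φ y • f y :=
  (hφ.continuous.smul hf).integrable_of_hasCompactSupport hφ.hasCompactSupport.smul_right

theorem IsMollifier.norm_integral_smul_le [NormedSpace ℝ F] (hφ : IsMollifier φ ε)
    {f : Euc d → F} {C : ℝ} (h : ∀ y, ‖y‖ ≤ ε → ‖f y‖ ≤ C) : ‖∫ y, φ y • f y‖ ≤ C := by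
  have h1 : ∫ y, φ y * C = C := by rw [integral_mul_const, hφ.integral_eq_one, one_mul]
  rw [← h1]
  refine norm_integral_le_of_norm_le (hφ.integrable.mul_const C) (Eventually.of_forall fun y => ?_)
  rw [norm_smul, Real.norm_of_nonneg (hφ.nonneg y)]
  rcases le_or_gt ‖y‖ ε with hy | hy
  · exact mul_le_mul_of_nonneg_left (h y hy) (hφ.nonneg y)
  · simp [hφ.eq_zero y hy]

theorem add_mem_cthickening {x y : Euc d} (hx : x ∈ K) (hy : ‖y‖ ≤ ε) :
    x + y ∈ Metric.cthickening ε K :=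
  Metric.mem_cthickening_of_dist_le _ x _ _ hx (by simpa using hy)

theorem continuous_resK_translate {Ω : Euc d → F} (hΩ : Continuous Ω) :
    Continuous fun y => resK K fun x => Ω (x + y) :=
  continuous_resK (f := fun y x => Ω (x + y))
    (hΩ.comp (continuous_snd.add continuous_fst))

variable [CompactSpace K]

/-- The average, with weight `φ`, of the translates of the function `Ω`, restricted to `K`. -/
def averageK [NormedSpace ℝ F] (K : Set (Euc d)) [CompactSpace K] (φ : Euc d → ℝ)
    (Ω : Euc d → F) : C(K, F) :=
  ∫ y, φ y • resK K fun x => Ω (x + y)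

theorem averageK_add [NormedSpace ℝ F] (hφ : IsMollifier φ ε) {Ω₁ Ω₂ : Euc d → F}
    (h₁ : Continuous Ω₁) (h₂ : Continuous Ω₂) :
    averageK K φ (Ω₁ + Ω₂) = averageK K φ Ω₁ + averageK K φ Ω₂ := by
  rw [averageK, averageK, averageK, ← integral_add
    (hφ.integrable_smul (continuous_resK_translate h₁))
    (hφ.integrable_smul (continuous_resK_translate h₂))]
  refine integral_congr_ae (Eventually.of_forall fun y => ?_)
  have h := resK_add (K := K) (h₁.comp (continuous_add_const y)) (h₂.comp (continuous_add_const y))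
  exact (congrArg (φ y • ·) h).trans (smul_add _ _ _)

theorem averageK_smul [NormedSpace ℝ F] (c : ℝ) {Ω : Euc d → F} (h : Continuous Ω) :
    averageK K φ (c • Ω) = c • averageK K φ Ω := by
  rw [averageK, averageK, ← integral_smul]
  refine integral_congr_ae (Eventually.of_forall fun y => ?_)
  have h' := resK_smul (K := K) c (h.comp (continuous_add_const y))
  exact (congrArg (φ y • ·) h').trans (smul_comm _ _ _)

theorem apply_averageK (hφ : IsMollifier φ ε) (A : Chain K k) {Ω : Euc d → Covector d k}
    (hΩ : Continuous Ω) :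
    A (averageK K φ Ω) = ∫ y, φ y * A (resK K fun x => Ω (x + y)) := by
  have h := ContinuousLinearMap.integral_comp_comm A
    (hφ.integrable_smul (continuous_resK_translate (K := K) hΩ))
  simpa [averageK] using h.symm

theorem norm_averageK_le [NormedSpace ℝ F] (hφ : IsMollifier φ ε) {Ω : Euc d → F}
    (hΩ : Continuous Ω) {C : ℝ} (hC : 0 ≤ C) (h : ∀ z ∈ Metric.cthickening ε K, ‖Ω z‖ ≤ C) :
    ‖averageK K φ Ω‖ ≤ C :=
  hφ.norm_integral_smul_le fun y hy => norm_resK_le (hΩ.comp (continuous_add_const y)) hC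
    fun _ hx => h _ (add_mem_cthickening hx hy)

/-- The average is a convolution, in which the weight carries the dependence on the point `x`. -/
theorem averageK_apply [NormedSpace ℝ F] [CompleteSpace F] (hφ : IsMollifier φ ε) {Ω : Euc d → F}
    (hΩ : Continuous Ω) (x : K) : averageK K φ Ω x = ∫ z, φ (z - x) • Ω z := by
  rw [averageK, integral_resK_apply (hφ.integrable_smul (continuous_resK_translate hΩ)),
    ← integral_sub_right_eq_self _ (x : Euc d)]
  refine integral_congr_ae (Eventually.of_forall fun z => ?_)
  have h := resK_apply (K := K) (hΩ.comp (continuous_add_const (z - (x : Euc d)))) x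
  have h' : (x : Euc d) + (z - x) = z := by abel
  simp only [ContinuousMap.smul_apply]
  exact congrArg (φ (z - x) • ·) (h.trans (congrArg Ω h'))

/-- The modulus of continuity of an average depends only on the weight and on a bound for the
averaged function near `K`. -/
theorem norm_averageK_sub_le [NormedSpace ℝ F] [CompleteSpace F] (hφ : IsMollifier φ ε)
    {Ω : Euc d → F} (hΩ : Continuous Ω) {C η : ℝ} (hη : 0 ≤ η)
    (h : ∀ z ∈ Metric.cthickening ε K, ‖Ω z‖ ≤ C) {x x' : K}
    (hx : ∀ z, |φ (z - x) - φ (z - x')| ≤ η) :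
    ‖averageK K φ Ω x - averageK K φ Ω x'‖ ≤
      η * C * volume.real (Metric.cthickening ε K) := by
  have hint : ∀ x : K, Integrable fun z => φ (z - x) • Ω z := by
    intro x
    have hs : HasCompactSupport fun z : Euc d => φ (z - x) :=
      hφ.hasCompactSupport.comp_homeomorph (Homeomorph.subRight (x : Euc d))
    have hc : Continuous fun z : Euc d => φ (z - x) :=
      hφ.continuous.comp (continuous_id.sub continuous_const)
    exact (hc.smul hΩ).integrable_of_hasCompactSupport hs.smul_right
  have hK : IsCompact (Metric.cthickening ε K) :=
    (isCompact_iff_compactSpace.2 inferInstance).cthickening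
  have hzero : ∀ (x : K) (z : Euc d), z ∉ Metric.cthickening ε K → φ (z - x) = 0 := by
    intro x z hz
    apply hφ.eq_zero
    by_contra! hle
    exact hz (by simpa using add_mem_cthickening x.2 hle)
  rw [averageK_apply hφ hΩ, averageK_apply hφ hΩ, ← integral_sub (hint x) (hint x'),
    ← setIntegral_eq_integral_of_forall_compl_eq_zero (s := Metric.cthickening ε K)
      (fun z hz => by simp [hzero _ z hz])]
  refine norm_setIntegral_le_of_norm_le_const hK.measure_lt_top fun z hz => ?_
  rw [← sub_smul, norm_smul]
  exact mul_le_mul (hx z) (h z hz) (norm_nonneg _) hη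

/-- The Arzelà–Ascoli theorem for `C(X, F)`, with total boundedness as the conclusion. -/
theorem totallyBounded_of_equicontinuous {X : Type*} [TopologicalSpace X] [CompactSpace X]
    [ProperSpace F] {A : Set C(X, F)} {C : ℝ} (hC : ∀ f ∈ A, ∀ x, ‖f x‖ ≤ C)
    (hA : Equicontinuous fun f : A => ((f : C(X, F)) : X → F)) : TotallyBounded A := by
  let e := ContinuousMap.isometryEquivBoundedOfCompact X F
  have h : IsCompact (closure (e '' A)) := by
    refine BoundedContinuousFunction.arzela_ascoli (Metric.closedBall 0 C)
      (isCompact_closedBall 0 C) (e '' A) ?_ ?_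
    · rintro _ x ⟨f, hf, rfl⟩
      simpa using! hC f hf x
    · intro x U hU
      filter_upwards [hA x U hU] with y hy
      rintro ⟨_, f, hf, rfl⟩
      exact hy ⟨f, hf⟩
  have h' := (h.totallyBounded.subset subset_closure).image e.symm.isometry.uniformContinuous
  rwa [← Set.image_comp, show (e.symm ∘ e : C(X, F) → C(X, F)) = id from
    funext e.symm_apply_apply, Set.image_id] at h'

/-- Averaging is a compact operation, by the Arzelà–Ascoli theorem. -/
theorem totallyBounded_averageK [NormedSpace ℝ F] [ProperSpace F] (hφ : IsMollifier φ ε) (C : ℝ) :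
    TotallyBounded {f : C(K, F) | ∃ Ω : Euc d → F, ContDiff ℝ (⊤ : ℕ∞) Ω ∧
      (∀ z ∈ Metric.cthickening ε K, ‖Ω z‖ ≤ C) ∧ f = averageK K φ Ω} := by
  rcases lt_or_ge C 0 with hC | hC
  · refine totallyBounded_of_equicontinuous (C := 0) ?_ ?_
    · rintro f ⟨Ω, -, h, -⟩ x
      exact absurd ((norm_nonneg _).trans (h x (Metric.self_subset_cthickening K x.2))) hC.not_ge
    · intro x U hU
      refine Eventually.of_forall ?_
      rintro y ⟨f, Ω, -, h, -⟩
      exact absurd ((norm_nonneg _).trans (h x (Metric.self_subset_cthickening K x.2))) hC.not_ge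
  refine totallyBounded_of_equicontinuous (C := C) ?_ ?_
  · rintro f ⟨Ω, hΩ, h, rfl⟩ x
    exact (ContinuousMap.norm_coe_le_norm _ x).trans (norm_averageK_le hφ hΩ.continuous hC h)
  · intro x
    rw [Metric.equicontinuousAt_iff]
    intro r hr
    set D := C * volume.real (Metric.cthickening ε K)
    have hD : 0 ≤ D := by positivity
    obtain ⟨δ, hδ, hφδ⟩ := Metric.uniformContinuous_iff.1
      (hφ.hasCompactSupport.uniformContinuous_of_continuous hφ.continuous)
      (r / (D + 1)) (by positivity)
    refine ⟨δ, hδ, ?_⟩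
    rintro y hy ⟨f, Ω, hΩ, h, rfl⟩
    rw [dist_eq_norm]
    refine (norm_averageK_sub_le hφ hΩ.continuous (η := r / (D + 1)) (by positivity) h
      fun z => ?_).trans_lt ?_
    · rw [← Real.dist_eq]
      refine (hφδ ?_).le
      rw [dist_sub_left, dist_comm]
      exact hy
    · calc r / (D + 1) * C * volume.real (Metric.cthickening ε K) = r * (D / (D + 1)) := by
            simp only [D]; ring
        _ < r * 1 := by
            gcongr
            rw [div_lt_one (by positivity)]
            linarith
        _ = r := mul_one r

/-- The average over `y`, with weight `φ`, and over `t ∈ [0, 1]` of a family of functions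
`g y t`, restricted to `K`. -/
def doubleAverageK [NormedSpace ℝ F] (K : Set (Euc d)) [CompactSpace K] (φ : Euc d → ℝ)
    (g : Euc d → ℝ → Euc d → F) : C(K, F) :=
  ∫ y, φ y • ∫ t in (0 : ℝ)..1, resK K (g y t)

section DoubleAverage

variable {g g₁ g₂ : Euc d → ℝ → Euc d → F}

theorem continuous_family_right (hg : Continuous fun p : (Euc d × ℝ) × Euc d => g p.1.1 p.1.2 p.2)
    (y : Euc d) (t : ℝ) : Continuous (g y t) :=
  hg.comp (Continuous.prodMk_right (y, t))

theorem intervalIntegrable_resK_family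
    (hg : Continuous fun p : (Euc d × ℝ) × Euc d => g p.1.1 p.1.2 p.2) (y : Euc d) :
    IntervalIntegrable (fun t : ℝ => resK K (g y t)) volume 0 1 := by
  have h : Continuous fun p : ℝ × Euc d => g y p.1 p.2 :=
    hg.comp (f := fun p : ℝ × Euc d => ((y, p.1), p.2)) (by fun_prop)
  exact (continuous_resK (f := fun t => g y t) h).intervalIntegrable 0 1

variable [NormedSpace ℝ F]

theorem continuous_integral_resK_family
    (hg : Continuous fun p : (Euc d × ℝ) × Euc d => g p.1.1 p.1.2 p.2) :
    Continuous fun y => ∫ t in (0 : ℝ)..1, resK K (g y t) :=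
  intervalIntegral.continuous_parametric_intervalIntegral_of_continuous'
    (f := fun y t => resK K (g y t))
    (continuous_resK (f := fun p : Euc d × ℝ => g p.1 p.2) hg) 0 1

theorem doubleAverageK_add (hφ : IsMollifier φ ε)
    (h₁ : Continuous fun p : (Euc d × ℝ) × Euc d => g₁ p.1.1 p.1.2 p.2)
    (h₂ : Continuous fun p : (Euc d × ℝ) × Euc d => g₂ p.1.1 p.1.2 p.2) :
    doubleAverageK K φ (fun y t x => g₁ y t x + g₂ y t x) =
      doubleAverageK K φ g₁ + doubleAverageK K φ g₂ := by
  have h : ∀ y, ∫ t in (0 : ℝ)..1, resK K (fun x => g₁ y t x + g₂ y t x) =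
      (∫ t in (0 : ℝ)..1, resK K (g₁ y t)) + ∫ t in (0 : ℝ)..1, resK K (g₂ y t) := by
    intro y
    rw [← intervalIntegral.integral_add (intervalIntegrable_resK_family h₁ y)
      (intervalIntegrable_resK_family h₂ y)]
    exact intervalIntegral.integral_congr fun t _ =>
      resK_add (continuous_family_right h₁ y t) (continuous_family_right h₂ y t)
  simp only [doubleAverageK, h, smul_add]
  exact integral_add (hφ.integrable_smul (continuous_integral_resK_family h₁))
    (hφ.integrable_smul (continuous_integral_resK_family h₂))

theorem doubleAverageK_smul (c : ℝ)
    (h₁ : Continuous fun p : (Euc d × ℝ) × Euc d => g p.1.1 p.1.2 p.2) :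
    doubleAverageK K φ (fun y t x => c • g y t x) = c • doubleAverageK K φ g := by
  have h : ∀ y, ∫ t in (0 : ℝ)..1, resK K (fun x => c • g y t x) =
      c • ∫ t in (0 : ℝ)..1, resK K (g y t) := by
    intro y
    rw [← intervalIntegral.integral_smul]
    exact intervalIntegral.integral_congr fun t _ =>
      resK_smul c (continuous_family_right h₁ y t)
  simp only [doubleAverageK, h, smul_comm _ c]
  exact integral_smul c _

theorem norm_doubleAverageK_le (hφ : IsMollifier φ ε)
    (hg : Continuous fun p : (Euc d × ℝ) × Euc d => g p.1.1 p.1.2 p.2) {C : ℝ} (hC : 0 ≤ C)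
    (h : ∀ y, ‖y‖ ≤ ε → ∀ t ∈ Set.Icc (0 : ℝ) 1, ∀ x ∈ K, ‖g y t x‖ ≤ C) :
    ‖doubleAverageK K φ g‖ ≤ C := by
  refine hφ.norm_integral_smul_le fun y hy => ?_
  have h1 : ∀ t ∈ Set.uIoc (0 : ℝ) 1, ‖resK K (g y t)‖ ≤ C := by
    intro t ht
    rw [Set.uIoc_of_le zero_le_one] at ht
    exact norm_resK_le (continuous_family_right hg y t) hC (h y hy t ⟨ht.1.le, ht.2⟩)
  simpa using intervalIntegral.norm_integral_le_of_norm_le_const h1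

theorem apply_doubleAverageK [CompleteSpace F] (hφ : IsMollifier φ ε) (Q : C(K, F) →L[ℝ] ℝ)
    (hg : Continuous fun p : (Euc d × ℝ) × Euc d => g p.1.1 p.1.2 p.2) :
    Integrable (fun y => φ y * ∫ t in (0 : ℝ)..1, Q (resK K (g y t))) ∧
      Q (doubleAverageK K φ g) = ∫ y, φ y * ∫ t in (0 : ℝ)..1, Q (resK K (g y t)) := by
  have h : ∀ y, ∫ t in (0 : ℝ)..1, Q (resK K (g y t)) = Q (∫ t in (0 : ℝ)..1, resK K (g y t)) :=
    fun y => Q.intervalIntegral_comp_comm (intervalIntegrable_resK_family hg y)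
  have hc := hφ.integrable_smul (continuous_integral_resK_family (K := K) hg)
  simp only [h]
  refine ⟨hφ.integrable_smul (Q.continuous.comp (continuous_integral_resK_family hg)), ?_⟩
  rw [doubleAverageK, ← Q.integral_comp_comm hc]
  simp

end DoubleAverage

end Averaging

section Translation

variable {d k : ℕ} {K : Set (Euc d)} {φ : Euc d → ℝ} {ε : ℝ}

/-- The contraction of `Θ` with the constant vector field `y`, translated by `t • y`. -/
def contractAlong (Θ : Euc d → Covector d (k + 1)) (y : Euc d) (t : ℝ) :
    Euc d → Covector d k :=
  fun x => (Θ (x + t • y)).curryLeft y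

theorem continuous_contractAlong {Θ : Euc d → Covector d (k + 1)} (hΘ : Continuous Θ) :
    Continuous fun p : (Euc d × ℝ) × Euc d => contractAlong Θ p.1.1 p.1.2 p.2 := by
  have h1 : Continuous fun p : (Euc d × ℝ) × Euc d => p.2 + p.1.2 • p.1.1 := by fun_prop
  have h2 := ContinuousAlternatingMap.curryLeftLI (𝕜 := ℝ) (E := Euc d) (F := ℝ)
    (n := k) |>.continuous.comp (hΘ.comp h1)
  exact h2.clm_apply (continuous_fst.comp continuous_fst)

variable [CompactSpace K]

/-- The average, with weight `φ`, of the contractions of `Θ` with the constant vector fields `y`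
along the segments from `x` to `x + y`. It is the homotopy operator between the
identity and the averaging operator. -/
def contractK (K : Set (Euc d)) [CompactSpace K] (φ : Euc d → ℝ)
    (Θ : Euc d → Covector d (k + 1)) : C(K, Covector d k) :=
  doubleAverageK K φ (contractAlong Θ)

theorem contractAlong_add (Θ₁ Θ₂ : Euc d → Covector d (k + 1)) :
    contractAlong (Θ₁ + Θ₂) = fun y t x => contractAlong Θ₁ y t x + contractAlong Θ₂ y t x := by
  ext y t x v
  simp [contractAlong]

theorem contractAlong_smul (c : ℝ) (Θ : Euc d → Covector d (k + 1)) :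
    contractAlong (c • Θ) = fun y t x => c • contractAlong Θ y t x := by
  ext y t x v
  simp [contractAlong]

theorem contractK_add (hφ : IsMollifier φ ε) {Θ₁ Θ₂ : Euc d → Covector d (k + 1)}
    (h₁ : Continuous Θ₁) (h₂ : Continuous Θ₂) :
    contractK K φ (Θ₁ + Θ₂) = contractK K φ Θ₁ + contractK K φ Θ₂ := by
  have h := doubleAverageK_add (K := K) hφ (continuous_contractAlong h₁)
    (continuous_contractAlong h₂)
  rw [contractK, contractAlong_add]
  exact h

theorem contractK_smul (c : ℝ) {Θ : Euc d → Covector d (k + 1)} (h : Continuous Θ) :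
    contractK K φ (c • Θ) = c • contractK K φ Θ := by
  have h := doubleAverageK_smul (K := K) (φ := φ) c (continuous_contractAlong h)
  rw [contractK, contractAlong_smul]
  exact h

theorem norm_contractK_le (hφ : IsMollifier φ ε) (hε : 0 ≤ ε) {Θ : Euc d → Covector d (k + 1)}
    (hΘ : Continuous Θ) {C : ℝ} (hC : 0 ≤ C)
    (h : ∀ z ∈ Metric.cthickening ε K, ‖Θ z‖ ≤ C) : ‖contractK K φ Θ‖ ≤ ε * C := by
  refine norm_doubleAverageK_le hφ (continuous_contractAlong hΘ) (by positivity)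
    fun y hy t ht x hx => ?_
  have hty : ‖t • y‖ ≤ ε := by
    rw [norm_smul, Real.norm_of_nonneg ht.1]
    exact (mul_le_of_le_one_left (norm_nonneg _) ht.2).trans hy
  calc ‖(Θ (x + t • y)).curryLeft y‖ ≤ ‖(Θ (x + t • y)).curryLeft‖ * ‖y‖ :=
        ContinuousLinearMap.le_opNorm _ _
    _ ≤ C * ε := by
        rw [ContinuousAlternatingMap.norm_curryLeft]
        exact mul_le_mul (h _ (add_mem_cthickening hx hty)) hy (norm_nonneg _) hC
    _ = ε * C := mul_comm _ _

/-- The homotopy formula for a translation, on a boundary `Q`. -/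
theorem Chain.HasBoundary.apply_translate {V : Chain K (k + 1)} {Q : Chain K k}
    (hVQ : V.HasBoundary Q) {η : Euc d → Covector d k} (hη : ContDiff ℝ (⊤ : ℕ∞) η)
    (y : Euc d) :
    Q (resK K fun x => η (x + y)) = Q (resK K η) +
      ∫ t in (0 : ℝ)..1, Q (resK K (contractAlong (extDeriv η) y t)) := by
  let h : ℝ × Euc d → Euc d := fun p => p.2 + p.1 • y
  have hh : ContDiff ℝ (⊤ : ℕ∞) h := by fun_prop
  have hfd : ∀ p, fderiv ℝ h p =
      .snd ℝ ℝ (Euc d) + (ContinuousLinearMap.fst ℝ ℝ (Euc d)).smulRight y := by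
    intro p
    exact (hasFDerivAt_snd.add (hasFDerivAt_fst.smul_const y)).fderiv
  have e1 : pullbackForm (fun x => h (1, x)) η = fun x => η (x + y) := by
    rw [pullbackForm_slice hh]
    ext x v
    simp [sliceForm, pullbackForm, hfd, h, Function.comp_def]
  have e0 : pullbackForm (fun x => h (0, x)) η = η := by
    rw [pullbackForm_slice hh]
    ext x v
    simp [sliceForm, pullbackForm, hfd, h, Function.comp_def]
  have e2 : ∀ t, sliceContract (pullbackForm h (extDeriv η)) t =
      contractAlong (extDeriv η) y t := by
    intro t
    ext x v
    simp only [sliceContract, pullbackForm, hfd]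
    rw [ContinuousAlternatingMap.curryLeft_compContinuousLinearMap]
    simp [h, contractAlong, Function.comp_def]
  have key := hVQ.homotopy hh hη
  rw [e1, e0] at key
  simp only [e2] at key
  rw [← key]
  abel

/-- The homotopy formula for the averaging operator, on a boundary `Q`. -/
theorem Chain.HasBoundary.apply_averageK {V : Chain K (k + 1)} {Q : Chain K k}
    (hVQ : V.HasBoundary Q) (hφ : IsMollifier φ ε) {η : Euc d → Covector d k}
    (hη : ContDiff ℝ (⊤ : ℕ∞) η) :
    Q (averageK K φ η) = Q (resK K η) + Q (contractK K φ (extDeriv η)) := by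
  obtain ⟨hi, h⟩ := apply_doubleAverageK (K := K) hφ Q
    (continuous_contractAlong hη.extDeriv.continuous)
  rw [_root_.apply_averageK hφ Q hη.continuous, contractK, h]
  simp only [hVQ.apply_translate hη, mul_add]
  rw [integral_add (hφ.integrable.mul_const _) hi, integral_mul_const,
    hφ.integral_eq_one, one_mul]

end Translation

/-! ### Smooth approximation of the retraction -/

section Retraction

variable {d k : ℕ} {K : Set (Euc d)}

/-- Convolution with a mollifier approximates a Lipschitz map uniformly and does not increase its
Lipschitz constant. -/
theorem LipschitzWith.exists_contDiff_approx {L : ℝ≥0} {g : Euc d → Euc d}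
    (hg : LipschitzWith L g) {δ : ℝ} (hδ : 0 < δ) :
    ∃ ρ : Euc d → Euc d, ContDiff ℝ (⊤ : ℕ∞) ρ ∧ LipschitzWith L ρ ∧
      ∀ x, dist (ρ x) (g x) ≤ L * δ := by
  obtain ⟨φ, hφs, hφ⟩ := exists_contDiff_isMollifier d hδ
  have hint : ∀ x, Integrable fun t => φ t • g (x - t) := fun x =>
    hφ.integrable_smul (hg.continuous.comp (continuous_const.sub continuous_id))
  refine ⟨fun x => ∫ t, φ t • g (x - t), ?_, ?_, ?_⟩
  · exact hφ.hasCompactSupport.contDiff_convolution_left (ContinuousLinearMap.lsmul ℝ ℝ) hφs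
      hg.continuous.locallyIntegrable
  · refine LipschitzWith.of_dist_le_mul fun x x' => ?_
    rw [dist_eq_norm, ← integral_sub (hint x) (hint x')]
    simp only [← smul_sub]
    refine hφ.norm_integral_smul_le fun t _ => ?_
    rw [← dist_eq_norm]
    simpa using hg.dist_le_mul (x - t) (x' - t)
  · intro x
    have h1 : ∫ t, φ t • g x = g x := by
      rw [integral_smul_const, hφ.integral_eq_one, one_smul]
    simp only [dist_eq_norm]
    rw [← h1]
    rw [← integral_sub (hint x) (hφ.integrable.smul_const _)]
    simp only [← smul_sub]
    refine hφ.norm_integral_smul_le fun t ht => ?_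
    rw [← dist_eq_norm]
    refine (hg.dist_le_mul _ _).trans ?_
    gcongr
    simpa using ht

/-- Smooth maps with a common Lipschitz constant that converge uniformly, near `K`, to a retraction
onto `K`: they map the `ε₀`-neighbourhood of `K` ever closer to `K`, and they converge to the
identity on `K`. -/
structure IsSmoothRetraction (K : Set (Euc d)) (ρ : ℕ → Euc d → Euc d) (L : ℝ≥0) (ε₀ : ℝ) :
    Prop where
  contDiff : ∀ n, ContDiff ℝ (⊤ : ℕ∞) (ρ n)
  lipschitz : ∀ n, LipschitzWith L (ρ n)
  near : ∀ δ > 0, ∀ᶠ n in atTop, ∀ z ∈ Metric.cthickening ε₀ K, ∃ w ∈ K, dist (ρ n z) w ≤ δ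
  near_id : ∀ δ > 0, ∀ᶠ n in atTop, ∀ x ∈ K, dist (ρ n x) x ≤ δ

/-- The retraction is extended to `ℝ^d` as a Lipschitz map and mollified at scales tending to
zero. -/
theorem IsLipschitzNhdRetract.exists_isSmoothRetraction (hK : IsCompact K)
    (h : IsLipschitzNhdRetract K) :
    ∃ (ρ : ℕ → Euc d → Euc d) (L : ℝ≥0) (ε₀ : ℝ), 0 < ε₀ ∧ IsSmoothRetraction K ρ L ε₀ := by
  obtain ⟨U, r, L₀, hU, -, hr, hmaps, hid⟩ := h
  obtain ⟨ε₀, hε₀, hsub⟩ := hK.exists_cthickening_subset_open isOpen_interior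
    (subset_interior_iff_mem_nhdsSet.2 hU)
  replace hsub := hsub.trans interior_subset
  obtain ⟨g, hg, hrg⟩ := hr.extend_finite_dimension
  set L := lipschitzExtensionConstant (Euc d) * L₀
  choose ρ hρ hρL hρg using fun n : ℕ =>
    hg.exists_contDiff_approx (δ := 1 / ((n : ℝ) + 1)) (by positivity)
  have hlim : Tendsto (fun n : ℕ => (L : ℝ) * (1 / ((n : ℝ) + 1))) atTop (𝓝 0) := by
    simpa using (tendsto_one_div_add_atTop_nhds_zero_nat (𝕜 := ℝ)).const_mul (L : ℝ)
  refine ⟨ρ, L, ε₀, hε₀, hρ, hρL, fun δ hδ => ?_, fun δ hδ => ?_⟩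
  · filter_upwards [hlim.eventually (gt_mem_nhds hδ)] with n hn z hz
    refine ⟨r z, hmaps (hsub hz), ?_⟩
    rw [hrg (hsub hz)]
    exact (hρg n z).trans hn.le
  · filter_upwards [hlim.eventually (gt_mem_nhds hδ)] with n hn x hx
    have hxU : x ∈ U := hsub (Metric.self_subset_cthickening K hx)
    have : g x = x := by rw [← hrg hxU, hid hx, id]
    calc dist (ρ n x) x = dist (ρ n x) (g x) := by rw [this]
      _ ≤ δ := (hρg n x).trans hn.le

variable {ρ : ℕ → Euc d → Euc d} {L : ℝ≥0} {ε₀ : ℝ}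

theorem norm_pullbackForm_le {g : Euc d → Euc d} (hg : LipschitzWith L g)
    (ω : Euc d → Covector d k) (z : Euc d) :
    ‖pullbackForm g ω z‖ ≤ ‖ω (g z)‖ * (L : ℝ) ^ k :=
  ContinuousAlternatingMap.norm_compContinuousLinearMap_le_pow _ _
    (norm_fderiv_le_of_lipschitz ℝ hg)

/-- Pullbacks under the approximate retractions are controlled, near `K`, by the values on `K`. -/
theorem IsSmoothRetraction.norm_pullbackForm_le [CompactSpace K]
    (hρ : IsSmoothRetraction K ρ L ε₀) {ω : Euc d → Covector d k} (hω : UniformContinuous ω)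
    {c : ℝ} (hc : ‖resK K ω‖ < c) :
    ∀ᶠ n in atTop, ∀ z ∈ Metric.cthickening ε₀ K,
      ‖pullbackForm (ρ n) ω z‖ ≤ c * (L : ℝ) ^ k := by
  obtain ⟨δ, hδ, h⟩ := Metric.uniformContinuous_iff.1 hω _ (sub_pos.2 hc)
  filter_upwards [hρ.near (δ / 2) (by positivity)] with n hn z hz
  obtain ⟨w, hw, hzw⟩ := hn z hz
  refine (_root_.norm_pullbackForm_le (hρ.lipschitz n) ω z).trans ?_
  gcongr
  have h1 := h (hzw.trans_lt (half_lt_self hδ))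
  rw [dist_eq_norm] at h1
  have h2 := norm_le_norm_resK hω.continuous hw
  have h3 := norm_sub_norm_le (ω (ρ n z)) (ω w)
  linarith

theorem norm_sliceContract_pullbackForm_le (h : ℝ × Euc d → Euc d)
    (Θ : Euc d → Covector d (k + 1)) (t : ℝ) (x : Euc d) {C D : ℝ}
    (hC : ‖Θ (h (t, x))‖ ≤ C)
    (hD : ‖fderiv ℝ h (t, x) ∘L .inr ℝ ℝ (Euc d)‖ ≤ D) :
    ‖sliceContract (pullbackForm h Θ) t x‖ ≤ C * ‖fderiv ℝ h (t, x) (1, 0)‖ * D ^ k := by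
  have e : sliceContract (pullbackForm h Θ) t x =
      ((Θ (h (t, x))).curryLeft (fderiv ℝ h (t, x) (1, 0))).compContinuousLinearMap
        (fderiv ℝ h (t, x) ∘L .inr ℝ ℝ (Euc d)) := by
    simp only [sliceContract, pullbackForm]
    rw [ContinuousAlternatingMap.curryLeft_compContinuousLinearMap]
    rfl
  rw [e]
  refine (ContinuousAlternatingMap.norm_compContinuousLinearMap_le_pow _ _ hD).trans ?_
  have hD0 : 0 ≤ D := (norm_nonneg _).trans hD
  gcongr
  refine (ContinuousLinearMap.le_opNorm _ _).trans ?_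
  rw [ContinuousAlternatingMap.norm_curryLeft]
  gcongr

variable [CompactSpace K]

/-- The effect on a boundary of a Lipschitz map that is close to the identity on `K`, by the
homotopy formula for the affine homotopy. -/
theorem Chain.HasBoundary.abs_apply_pullbackForm_sub_le {V : Chain K (k + 1)} {Q : Chain K k}
    (hVQ : V.HasBoundary Q) {g : Euc d → Euc d} (hg : ContDiff ℝ (⊤ : ℕ∞) g)
    (hgL : LipschitzWith L g) {δ : ℝ} (hδ : 0 ≤ δ) (hgK : ∀ x ∈ K, dist (g x) x ≤ δ)
    {η : Euc d → Covector d k} (hη : ContDiff ℝ (⊤ : ℕ∞) η) {C : ℝ} (hC0 : 0 ≤ C)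
    (hC : ∀ x, ‖extDeriv η x‖ ≤ C) :
    |Q (resK K (pullbackForm g η)) - Q (resK K η)| ≤ ‖Q‖ * (C * δ * (2 + L : ℝ) ^ k) := by
  let h : ℝ × Euc d → Euc d := fun p => p.2 + p.1 • (g p.2 - p.2)
  have hh : ContDiff ℝ (⊤ : ℕ∞) h :=
    contDiff_snd.add (contDiff_fst.smul ((hg.comp contDiff_snd).sub contDiff_snd))
  have hfd : ∀ p : ℝ × Euc d, fderiv ℝ h p = .snd ℝ ℝ (Euc d) +
      (p.1 • (fderiv ℝ g p.2 ∘L .snd ℝ ℝ (Euc d) - .snd ℝ ℝ (Euc d)) +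
        (ContinuousLinearMap.fst ℝ ℝ (Euc d)).smulRight (g p.2 - p.2)) := by
    intro p
    have h1 : HasFDerivAt (fun q : ℝ × Euc d => g q.2) (fderiv ℝ g p.2 ∘L .snd ℝ ℝ (Euc d)) p :=
      ((hg.differentiable (by simp) p.2).hasFDerivAt).comp p hasFDerivAt_snd
    exact (hasFDerivAt_snd.add (hasFDerivAt_fst.smul (h1.sub hasFDerivAt_snd))).fderiv
  have e1 : (fun x => h (1, x)) = g := by
    ext1 x
    simp [h]
  have e0 : pullbackForm (fun x => h (0, x)) η = η := by
    ext x v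
    simp [h, pullbackForm]
  have key := hVQ.homotopy hh hη
  rw [e1, e0] at key
  rw [key]
  have hbound : ∀ t ∈ Set.uIoc (0 : ℝ) 1,
      ‖Q (resK K (sliceContract (pullbackForm h (extDeriv η)) t))‖ ≤
        ‖Q‖ * (C * δ * (2 + L : ℝ) ^ k) := by
    intro t ht
    rw [Set.uIoc_of_le zero_le_one] at ht
    refine (Q.le_opNorm _).trans ?_
    gcongr
    refine norm_resK_le (contDiff_sliceContract_right
      (hh.pullbackForm hη.extDeriv) t).continuous (by positivity) fun x hx => ?_
    have hD : ‖fderiv ℝ h (t, x) ∘L .inr ℝ ℝ (Euc d)‖ ≤ 2 + L := by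
      have : fderiv ℝ h (t, x) ∘L .inr ℝ ℝ (Euc d) =
          .id ℝ (Euc d) + t • (fderiv ℝ g x - .id ℝ (Euc d)) := by
        rw [hfd]
        ext v : 1
        simp
      rw [this]
      have h1 : ‖ContinuousLinearMap.id ℝ (Euc d)‖ ≤ 1 := ContinuousLinearMap.norm_id_le
      calc _ ≤ ‖ContinuousLinearMap.id ℝ (Euc d)‖ +
            ‖t • (fderiv ℝ g x - .id ℝ (Euc d))‖ := norm_add_le _ _
        _ ≤ 1 + 1 * (L + 1) := by
            rw [norm_smul, Real.norm_of_nonneg ht.1.le]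
            gcongr
            · exact ht.2
            · exact (norm_sub_le _ _).trans
                (add_le_add (norm_fderiv_le_of_lipschitz ℝ hgL) h1)
        _ = 2 + L := by ring
    refine (norm_sliceContract_pullbackForm_le h (extDeriv η) t x (hC _) hD).trans ?_
    gcongr
    rw [hfd]
    simpa [dist_eq_norm] using hgK x hx
  simpa using intervalIntegral.norm_integral_le_of_norm_le_const hbound

/-- On a boundary, the approximate retractions act in the limit as the identity. -/
theorem Chain.HasBoundary.tendsto_pullbackForm {V : Chain K (k + 1)} {Q : Chain K k}
    (hVQ : V.HasBoundary Q) (hρ : IsSmoothRetraction K ρ L ε₀)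
    {η : Euc d → Covector d k} (hη : ContDiff ℝ (⊤ : ℕ∞) η) {C : ℝ} (hC0 : 0 ≤ C)
    (hC : ∀ x, ‖extDeriv η x‖ ≤ C) :
    Tendsto (fun n => Q (resK K (pullbackForm (ρ n) η))) atTop (𝓝 (Q (resK K η))) := by
  rw [Metric.tendsto_nhds]
  intro r hr
  set D := ‖Q‖ * (C * (2 + L : ℝ) ^ k)
  have hD : 0 ≤ D := by positivity
  filter_upwards [hρ.near_id (r / (D + 1)) (by positivity)] with n hn
  rw [Real.dist_eq]
  refine (hVQ.abs_apply_pullbackForm_sub_le (hρ.contDiff n) (hρ.lipschitz n) (by positivity) hn hη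
    hC0 hC).trans_lt ?_
  calc _ = r * (D / (D + 1)) := by simp only [D]; ring
    _ < r * 1 := by
        gcongr
        rw [div_lt_one (by positivity)]
        linarith
    _ = r := mul_one r

end Retraction

/-! ### Limits of functionals, test forms and cutoffs -/

section FunctionalAnalysis

variable {E X : Type*} [AddCommGroup E] [Module ℝ E] [NormedAddCommGroup X] [NormedSpace ℝ X]

/-- Hahn–Banach for a linear functional that is bounded with respect to the seminorm induced by a
linear map into a normed space. -/
theorem exists_strongDual_of_abs_le (r : E →ₗ[ℝ] X) (ℓ : E →ₗ[ℝ] ℝ) {C : ℝ} (hC : 0 ≤ C)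
    (h : ∀ e, |ℓ e| ≤ C * ‖r e‖) :
    ∃ A : StrongDual ℝ X, ‖A‖ ≤ C ∧ ∀ e, A (r e) = ℓ e := by
  obtain ⟨g, hg⟩ := r.rangeRestrict.exists_rightInverse_of_surjective r.range_rangeRestrict
  have hrg : ∀ x : LinearMap.range r, r (g x) = x := fun x =>
    congrArg Subtype.val (LinearMap.congr_fun hg x)
  let f : StrongDual ℝ (LinearMap.range r) :=
    (ℓ ∘ₗ g).mkContinuous C fun x => by simpa [hrg] using h (g x)
  obtain ⟨A, hA, hn⟩ := exists_extension_norm_eq (LinearMap.range r) f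
  refine ⟨A, hn.trans_le (LinearMap.mkContinuous_norm_le _ hC _), fun e => ?_⟩
  have h1 : A (r e) = ℓ (g (r.rangeRestrict e)) := hA (r.rangeRestrict e)
  have h2 := h (g (r.rangeRestrict e) - e)
  rw [map_sub r, hrg] at h2
  rw [h1, ← sub_eq_zero, ← map_sub, ← abs_nonpos_iff]
  simpa using h2

/-- A limit along an ultrafilter of linear functionals that are asymptotically bounded with respect
to the seminorm induced by a linear map into a normed space. -/
theorem exists_strongDual_tendsto (r : E →ₗ[ℝ] X) (ℓ : ℕ → E →ₗ[ℝ] ℝ) {C : ℝ} (hC : 0 ≤ C)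
    (h : ∀ e c, ‖r e‖ < c → ∀ᶠ n in atTop, |ℓ n e| ≤ C * c) :
    ∃ A : StrongDual ℝ X, ‖A‖ ≤ C ∧
      ∀ e, Tendsto (fun n => ℓ n e) (hyperfilter ℕ : Filter ℕ) (𝓝 (A (r e))) := by
  have hle : (hyperfilter ℕ : Filter ℕ) ≤ atTop := Nat.hyperfilter_le_atTop
  have hlim : ∀ e, ∃ a, Tendsto (fun n => ℓ n e) (hyperfilter ℕ : Filter ℕ) (𝓝 a) := by
    intro e
    have hev := hle (h e (‖r e‖ + 1) (lt_add_one _))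
    obtain ⟨a, -, ha⟩ := (isCompact_Icc (a := -(C * (‖r e‖ + 1)))
      (b := C * (‖r e‖ + 1))).ultrafilter_le_nhds ((hyperfilter ℕ).map fun n => ℓ n e) (by
        rw [le_principal_iff, Ultrafilter.mem_coe, Ultrafilter.mem_map]
        filter_upwards [hev] with n hn using abs_le.1 hn)
    exact ⟨a, ha⟩
  choose a ha using hlim
  let ℓ' : E →ₗ[ℝ] ℝ :=
    { toFun := a
      map_add' := fun x y => tendsto_nhds_unique (ha (x + y)) (by simpa using (ha x).add (ha y))
      map_smul' := fun c x => tendsto_nhds_unique (ha (c • x))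
        (by simpa using (ha x).const_mul c) }
  obtain ⟨A, hA, hAr⟩ := exists_strongDual_of_abs_le r ℓ' hC fun e => by
    have h1 : ∀ c, ‖r e‖ < c → |ℓ' e| ≤ C * c := fun c hc =>
      le_of_tendsto (ha e).abs (hle (h e c hc))
    refine ge_of_tendsto (x := 𝓝[>] ‖r e‖) (f := fun c => C * c) ?_ ?_
    · exact ((continuous_const.mul continuous_id).tendsto _).mono_left nhdsWithin_le_nhds
    · filter_upwards [self_mem_nhdsWithin] with c hc using h1 c hc
  exact ⟨A, hA, fun e => by rw [hAr]; exact ha e⟩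

/-- Bounded functionals that converge to zero pointwise on a totally bounded set do so uniformly. -/
theorem TotallyBounded.eventually_forall_abs_le {ι : Type*} {l : Filter ι}
    {V : ι → StrongDual ℝ X} {C : ℝ} (hC : ∀ i, ‖V i‖ ≤ C) {A : Set X} (hA : TotallyBounded A)
    (hV : ∀ f ∈ A, Tendsto (fun i => V i f) l (𝓝 0)) {δ : ℝ} (hδ : 0 < δ) :
    ∀ᶠ i in l, ∀ f ∈ A, |V i f| ≤ δ := by
  have hη : 0 < δ / (2 * (|C| + 1)) := by positivity
  obtain ⟨t, htA, ht, hcov⟩ := Metric.finite_approx_of_totallyBounded hA _ hη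
  have h1 : ∀ᶠ i in l, ∀ f ∈ t, |V i f| < δ / 2 :=
    (ht.eventually_all).2 fun f hf => by
      simpa using (hV f (htA hf)).abs.eventually (gt_mem_nhds (by simpa using hδ))
  filter_upwards [h1] with i hi f hf
  obtain ⟨g, hg, hfg⟩ := Set.mem_iUnion₂.1 (hcov hf)
  rw [Metric.mem_ball, dist_eq_norm] at hfg
  have h2 : |V i (f - g)| ≤ δ / 2 := by
    calc |V i (f - g)| ≤ ‖V i‖ * ‖f - g‖ := (V i).le_opNorm _
      _ ≤ (|C| + 1) * (δ / (2 * (|C| + 1))) := by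
          gcongr
          exact ((hC i).trans (le_abs_self C)).trans (by linarith)
      _ = δ / 2 := by field_simp
  have h3 : V i f = V i (f - g) + V i g := by rw [map_sub]; ring
  rw [h3]
  exact (abs_add_le _ _).trans (by linarith [hi g hg])

end FunctionalAnalysis

section TestForms

variable {d k : ℕ} {K : Set (Euc d)}

theorem TestForm.contDiff (ω : TestForm d k) : ContDiff ℝ (⊤ : ℕ∞) ω :=
  TestFunction.contDiff ω

theorem TestForm.uniformContinuous (ω : TestForm d k) : UniformContinuous ω :=
  ω.hasCompactSupport.uniformContinuous_of_continuous ω.continuous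

theorem TestForm.coe_extDerivCLM (ω : TestForm d k) :
    (TestForm.extDerivCLM d k ω : Euc d → Covector d (k + 1)) = extDeriv ω :=
  funext fun x => TestForm.extDerivCLM_apply ω x

/-- The product of a test form and a smooth function. -/
def TestForm.mulLeft (χ : Euc d → ℝ) (hχ : ContDiff ℝ (⊤ : ℕ∞) χ) (ω : TestForm d k) :
    TestForm d k where
  toFun := fun x => χ x • ω x
  contDiff' := hχ.smul ω.contDiff
  hasCompactSupport' := HasCompactSupport.intro (K := tsupport ω) ω.hasCompactSupport
    fun x hx => by rw [image_eq_zero_of_notMem_tsupport hx, smul_zero]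
  tsupport_subset' := fun _ _ => trivial

theorem exists_contDiff_cutoff {s t : Set (Euc d)} (hs : IsClosed s) (h : s ⊆ interior t) :
    ∃ χ : Euc d → ℝ, ContDiff ℝ (⊤ : ℕ∞) χ ∧ (∀ᶠ x in 𝓝ˢ s, χ x = 1) ∧ (∀ x ∉ t, χ x = 0) ∧
      ∀ x, χ x ∈ Set.Icc (0 : ℝ) 1 := by
  obtain ⟨f, h1, h0, hf⟩ := exists_contMDiffMap_one_nhds_of_subset_interior (n := ⊤)
    (modelWithCornersSelf ℝ (Euc d)) hs h
  exact ⟨f, f.contMDiff.contDiff, h1, h0, hf⟩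

theorem exists_testForm_eventuallyEq (hK : IsCompact K) {f : Euc d → Covector d k}
    (hf : ContDiff ℝ (⊤ : ℕ∞) f) : ∃ ω : TestForm d k, ∀ᶠ x in 𝓝ˢ K, ω x = f x := by
  have hsub : K ⊆ interior (Metric.cthickening 1 K) :=
    (Metric.self_subset_thickening one_pos K).trans
      (interior_maximal (Metric.thickening_subset_cthickening 1 K) Metric.isOpen_thickening)
  obtain ⟨χ, hχ, h1, h0, -⟩ := exists_contDiff_cutoff hK.isClosed hsub
  refine ⟨⟨fun x => χ x • f x, hχ.smul hf, ?_, fun _ _ => trivial⟩, ?_⟩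
  · exact HasCompactSupport.intro (K := Metric.cthickening 1 K) hK.cthickening fun x hx => by
      simp [h0 x hx]
  · filter_upwards [h1] with x hx
    change χ x • f x = f x
    rw [hx, one_smul]

variable [CompactSpace K]

/-- As `K` is compact, boundaries may be tested with compactly supported forms only. -/
theorem Chain.HasBoundary.of_testForm {V : Chain K (k + 1)} {Q : Chain K k}
    (h : ∀ η : TestForm d k, V (resK K (extDeriv η)) = Q (resK K η)) : V.HasBoundary Q := by
  intro η hη
  obtain ⟨ω, hω⟩ := exists_testForm_eventuallyEq
    (isCompact_iff_compactSpace.2 (inferInstance : CompactSpace K)) hη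
  have h1 : ∀ x ∈ K, ω x = η x := fun x hx => hω.self_of_nhdsSet x hx
  have h2 : ∀ x ∈ K, extDeriv ω x = extDeriv η x := fun x hx =>
    Filter.EventuallyEq.extDeriv_eq (nhds_le_nhdsSet hx hω)
  rw [← resK_congr h1, ← resK_congr h2]
  exact h ω

theorem Chain.HasBoundary.add {V₁ V₂ : Chain K (k + 1)} {Q₁ Q₂ : Chain K k}
    (h₁ : V₁.HasBoundary Q₁) (h₂ : V₂.HasBoundary Q₂) : HasBoundary (V₁ + V₂) (Q₁ + Q₂) :=
  fun η hη => congrArg₂ (· + ·) (h₁ η hη) (h₂ η hη)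

theorem Chain.HasBoundary.sub {V₁ V₂ : Chain K (k + 1)} {Q₁ Q₂ : Chain K k}
    (h₁ : V₁.HasBoundary Q₁) (h₂ : V₂.HasBoundary Q₂) : HasBoundary (V₁ - V₂) (Q₁ - Q₂) :=
  fun η hη => congrArg₂ (· - ·) (h₁ η hη) (h₂ η hη)

theorem Chain.HasBoundary.smul (c : ℝ) {V : Chain K (k + 1)} {Q : Chain K k}
    (h : V.HasBoundary Q) : HasBoundary (c • V) (c • Q) :=
  fun η hη => congrArg (c * ·) (h η hη)

/-- A bounded sequence of functionals that tends to zero on test forms tends to zero on averages of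
smooth forms, by dominated convergence. -/
theorem tendsto_apply_averageK {φ : Euc d → ℝ} {ε : ℝ} (hφ : IsMollifier φ ε) {S : ℕ → Chain K k}
    {M : ℝ} (hM : ∀ j, ‖S j‖ ≤ M)
    (hS : ∀ ω : TestForm d k, Tendsto (fun j => S j (resK K ω)) atTop (𝓝 0))
    {Ω : Euc d → Covector d k} (hΩ : ContDiff ℝ (⊤ : ℕ∞) Ω) :
    Tendsto (fun j => S j (averageK K φ Ω)) atTop (𝓝 0) := by
  have hc := continuous_resK_translate (K := K) hΩ.continuous
  simp only [apply_averageK hφ _ hΩ.continuous]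
  rw [← integral_zero (Euc d) ℝ]
  refine tendsto_integral_of_dominated_convergence
    (fun y => φ y * (M * ‖resK K fun x => Ω (x + y)‖)) ?_ ?_ ?_ ?_
  · intro j
    exact (hφ.continuous.mul ((S j).continuous.comp hc)).aestronglyMeasurable
  · exact hφ.integrable_smul (continuous_const.mul hc.norm)
  · intro j
    refine Eventually.of_forall fun y => ?_
    rw [norm_mul, Real.norm_of_nonneg (hφ.nonneg y)]
    refine mul_le_mul_of_nonneg_left (((S j).le_opNorm _).trans ?_) (hφ.nonneg y)
    gcongr
    exact hM j
  · refine Eventually.of_forall fun y => ?_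
    obtain ⟨ω, hω⟩ := exists_testForm_eventuallyEq
      (isCompact_iff_compactSpace.2 (inferInstance : CompactSpace K))
      (hΩ.comp (contDiff_id.add contDiff_const) : ContDiff ℝ (⊤ : ℕ∞) fun x => Ω (x + y))
    have e : resK K ω = resK K fun x => Ω (x + y) :=
      resK_congr fun x hx => hω.self_of_nhdsSet x hx
    have h1 := (hS ω).const_mul (φ y)
    rw [e, mul_zero] at h1
    exact h1

end TestForms

/-! ### Norms and limits in the dual of `C(K, F)` -/

section DualC

variable {d : ℕ} {K : Set (Euc d)} [CompactSpace K] {F : Type*} [NormedAddCommGroup F]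
  [NormedSpace ℝ F]

/- The following facts are stated for functions with values in an arbitrary normed space `F`. For
`F = Covector d k` the topology on `F` is found along two instance paths, which prevents the general
lemmas on normed groups and dual spaces from applying directly to `Chain K k`. -/

theorem DualC.norm_nonneg (A : DualC K F) : 0 ≤ ‖A‖ :=
  _root_.norm_nonneg A

theorem DualC.norm_zero : ‖(0 : DualC K F)‖ = 0 :=
  _root_.norm_zero

theorem DualC.norm_pos {A : DualC K F} (hA : A ≠ 0) : 0 < ‖A‖ :=
  norm_pos_iff.2 hA

theorem DualC.norm_smul_of_nonneg {c : ℝ} (hc : 0 ≤ c) (A : DualC K F) : ‖c • A‖ = c * ‖A‖ := by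
  rw [norm_smul, Real.norm_of_nonneg hc]

theorem DualC.norm_sub_le (A B : DualC K F) : ‖A - B‖ ≤ ‖A‖ + ‖B‖ :=
  _root_.norm_sub_le A B

theorem exists_dualC_of_abs_le {E : Type*} [AddCommGroup E] [Module ℝ E] (r : E → C(K, F))
    (hadd : ∀ x y, r (x + y) = r x + r y) (hsmul : ∀ (c : ℝ) x, r (c • x) = c • r x)
    (ℓ : E →ₗ[ℝ] ℝ) {C : ℝ} (hC : 0 ≤ C) (h : ∀ e, |ℓ e| ≤ C * ‖r e‖) :
    ∃ A : DualC K F, ‖A‖ ≤ C ∧ ∀ e, A (r e) = ℓ e :=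
  exists_strongDual_of_abs_le ⟨⟨r, hadd⟩, hsmul⟩ ℓ hC h

theorem exists_dualC_tendsto {E : Type*} [AddCommGroup E] [Module ℝ E] (r : E → C(K, F))
    (hadd : ∀ x y, r (x + y) = r x + r y) (hsmul : ∀ (c : ℝ) x, r (c • x) = c • r x)
    (ℓ : ℕ → E →ₗ[ℝ] ℝ) {C : ℝ} (hC : 0 ≤ C)
    (h : ∀ e c, ‖r e‖ < c → ∀ᶠ n in atTop, |ℓ n e| ≤ C * c) :
    ∃ A : DualC K F, ‖A‖ ≤ C ∧
      ∀ e, Tendsto (fun n => ℓ n e) (hyperfilter ℕ : Filter ℕ) (𝓝 (A (r e))) :=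
  exists_strongDual_tendsto ⟨⟨r, hadd⟩, hsmul⟩ ℓ hC h

/-- Sequences of functionals of norm at most one have weak-* limits along an ultrafilter. -/
theorem DualC.exists_weakLimit {R : ℕ → DualC K F} (hR : ∀ n, ‖R n‖ = 1) :
    ∃ A : DualC K F, ‖A‖ ≤ 1 ∧
      ∀ f, Tendsto (fun n => R n f) (hyperfilter ℕ : Filter ℕ) (𝓝 (A f)) :=
  exists_strongDual_tendsto (LinearMap.id (R := ℝ) (M := C(K, F)))
    (fun n => (R n : C(K, F) →ₗ[ℝ] ℝ)) zero_le_one fun f c hc => Eventually.of_forall fun n => by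
      have h1 := (R n).le_opNorm f
      rw [hR] at h1
      exact h1.trans (mul_le_mul_of_nonneg_left hc.le zero_le_one)

end DualC

/-! ### The smoothing operators -/

section Decomposition

variable {d k : ℕ} {K : Set (Euc d)} {φ : Euc d → ℝ} {ε ε₀ δ : ℝ} {ρ : ℕ → Euc d → Euc d}
  {L : ℝ≥0}

theorem pullbackForm_add (g : Euc d → Euc d) (ω η : Euc d → Covector d k) :
    pullbackForm g (ω + η) = pullbackForm g ω + pullbackForm g η := by
  ext x v
  simp [pullbackForm]

theorem pullbackForm_smul (g : Euc d → Euc d) (c : ℝ) (ω : Euc d → Covector d k) :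
    pullbackForm g (c • ω) = c • pullbackForm g ω := by
  ext x v
  simp [pullbackForm]

theorem extDeriv_translate (η : Euc d → Covector d k) (y : Euc d) :
    extDeriv (fun x => η (x + y)) = fun x => extDeriv η (x + y) := by
  ext1 x
  rw [extDeriv, fderiv_comp_add_right, extDeriv]

variable [CompactSpace K]

/-- Averaging commutes with the boundary. -/
theorem Chain.HasBoundary.apply_averageK_extDeriv {V : Chain K (k + 1)} {Q : Chain K k}
    (hVQ : V.HasBoundary Q) (hφ : IsMollifier φ ε) {η : Euc d → Covector d k}
    (hη : ContDiff ℝ (⊤ : ℕ∞) η) : V (averageK K φ (extDeriv η)) = Q (averageK K φ η) := by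
  rw [_root_.apply_averageK hφ V hη.extDeriv.continuous,
    _root_.apply_averageK hφ Q hη.continuous]
  refine integral_congr_ae (Eventually.of_forall fun y => ?_)
  have hy : ContDiff ℝ (⊤ : ℕ∞) fun x => η (x + y) := hη.comp (contDiff_id.add contDiff_const)
  have h := hVQ _ hy
  rw [extDeriv_translate] at h
  simp only [h]

/-- The functional `V` is at most `δ` on the averages of all forms that are bounded by `B` near
`K`. -/
def IsSmallOnAverages (V : Chain K k) (φ : Euc d → ℝ) (ε B δ : ℝ) : Prop :=
  ∀ Ω : Euc d → Covector d k, ContDiff ℝ (⊤ : ℕ∞) Ω →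
    (∀ z ∈ Metric.cthickening ε K, ‖Ω z‖ ≤ B) → |V (averageK K φ Ω)| ≤ δ

/-- Bounded functionals that converge to zero pointwise on averages are uniformly small on
averages. -/
theorem eventually_isSmallOnAverages (hφ : IsMollifier φ ε) {l : Filter ℕ} {V : ℕ → Chain K k}
    {M : ℝ} (hM : ∀ i, ‖V i‖ ≤ M)
    (hV : ∀ Ω : Euc d → Covector d k, ContDiff ℝ (⊤ : ℕ∞) Ω →
      Tendsto (fun i => V i (averageK K φ Ω)) l (𝓝 0)) (B : ℝ) (hδ : 0 < δ) :
    ∀ᶠ i in l, IsSmallOnAverages (V i) φ ε B δ := by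
  have : ProperSpace (Covector d k) := FiniteDimensional.proper ℝ _
  have h := (totallyBounded_averageK (K := K) (F := Covector d k) hφ B).eventually_forall_abs_le hM
    (by rintro f ⟨Ω, hΩ, -, rfl⟩; exact hV Ω hΩ) hδ
  filter_upwards [h] with i hi Ω hΩ hB
  exact hi _ ⟨Ω, hΩ, hB, rfl⟩

/-- The defining property of `IsSmallOnAverages`, rescaled. -/
theorem IsSmallOnAverages.abs_le {V : Chain K k} {B c : ℝ}
    (hV : IsSmallOnAverages V φ ε B δ) (hc : 0 < c) {Ω : Euc d → Covector d k}
    (hΩ : ContDiff ℝ (⊤ : ℕ∞) Ω) (h : ∀ z ∈ Metric.cthickening ε K, ‖Ω z‖ ≤ c * B) :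
    |V (averageK K φ Ω)| ≤ δ * c := by
  have h1 := hV (c⁻¹ • Ω) (hΩ.const_smul c⁻¹) fun z hz => by
    rw [Pi.smul_apply, norm_smul, Real.norm_of_nonneg (by positivity)]
    exact inv_mul_le_of_le_mul₀ hc.le ((mul_nonneg_iff_of_pos_left hc).1
      ((norm_nonneg _).trans (h z hz))) (h z hz)
  rw [averageK_smul _ hΩ.continuous, map_smul, smul_eq_mul, abs_mul,
    abs_of_nonneg (by positivity)] at h1
  rw [mul_comm δ]
  exact (inv_mul_le_iff₀ hc).1 h1

/-- The smoothing operator: the limit of the averages of the pullbacks under the approximate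
retractions. It is small on functionals that are small on averages. -/
theorem IsSmoothRetraction.exists_average_limit (hρ : IsSmoothRetraction K ρ L ε₀)
    (hφ : IsMollifier φ ε) (hε₀ : ε ≤ ε₀) {V : Chain K k} (hδ : 0 ≤ δ)
    (hV : IsSmallOnAverages V φ ε ((L : ℝ) ^ k) δ) :
    ∃ A : Chain K k, ‖A‖ ≤ δ ∧ ∀ ω : TestForm d k,
      Tendsto (fun n => V (averageK K φ (pullbackForm (ρ n) ω))) (hyperfilter ℕ : Filter ℕ)
        (𝓝 (A (resK K ω))) := by
  have hs : ∀ n (ω : TestForm d k), ContDiff ℝ (⊤ : ℕ∞) (pullbackForm (ρ n) ω) := fun n ω =>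
    (hρ.contDiff n).pullbackForm ω.contDiff
  let ℓ : ℕ → TestForm d k →ₗ[ℝ] ℝ := fun n =>
    { toFun := fun ω => V (averageK K φ (pullbackForm (ρ n) ω))
      map_add' := fun ω η => by
        have h := pullbackForm_add (ρ n) ω η
        rw [← map_add, ← averageK_add hφ (hs n ω).continuous (hs n η).continuous, ← h]
        rfl
      map_smul' := fun c ω => by
        have h := pullbackForm_smul (ρ n) c ω
        rw [RingHom.id_apply, ← map_smul, ← averageK_smul c (hs n ω).continuous, ← h]
        rfl }
  refine exists_dualC_tendsto (fun ω : TestForm d k => resK K ω)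
    (fun ω η => resK_add ω.continuous η.continuous) (fun c ω => resK_smul c ω.continuous) ℓ hδ
    fun ω c hc => ?_
  filter_upwards [hρ.norm_pullbackForm_le ω.uniformContinuous hc] with n hn
  exact hV.abs_le ((norm_nonneg _).trans_lt hc) (hs n ω)
    fun z hz => hn z (Metric.cthickening_mono hε₀ K hz)

/-- The limit of the averaged contractions of the pullbacks under the approximate retractions: the
homotopy operator between the identity and the smoothing operator. -/
theorem IsSmoothRetraction.exists_contract_limit (hρ : IsSmoothRetraction K ρ L ε₀)
    (hφ : IsMollifier φ ε) (hε : 0 ≤ ε) (hε₀ : ε ≤ ε₀) (S : Chain K k) :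
    ∃ G : Chain K (k + 1), ‖G‖ ≤ ε * (L : ℝ) ^ (k + 1) * ‖S‖ ∧ ∀ ω : TestForm d (k + 1),
      Tendsto (fun n => S (contractK K φ (pullbackForm (ρ n) ω))) (hyperfilter ℕ : Filter ℕ)
        (𝓝 (G (resK K ω))) := by
  have hs : ∀ n (ω : TestForm d (k + 1)), Continuous (pullbackForm (ρ n) ω) := fun n ω =>
    ((hρ.contDiff n).pullbackForm ω.contDiff).continuous
  let ℓ : ℕ → TestForm d (k + 1) →ₗ[ℝ] ℝ := fun n =>
    { toFun := fun ω => S (contractK K φ (pullbackForm (ρ n) ω))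
      map_add' := fun ω η => by
        have h := pullbackForm_add (ρ n) ω η
        rw [← map_add, ← contractK_add hφ (hs n ω) (hs n η), ← h]
        rfl
      map_smul' := fun c ω => by
        have h := pullbackForm_smul (ρ n) c ω
        rw [RingHom.id_apply, ← map_smul, ← contractK_smul c (hs n ω), ← h]
        rfl }
  refine exists_dualC_tendsto (fun ω : TestForm d (k + 1) => resK K ω)
    (fun ω η => resK_add ω.continuous η.continuous) (fun c ω => resK_smul c ω.continuous) ℓ
    (by positivity) fun ω c hc => ?_
  have hc0 : 0 < c := (norm_nonneg _).trans_lt hc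
  filter_upwards [hρ.norm_pullbackForm_le ω.uniformContinuous hc] with n hn
  calc |ℓ n ω| ≤ ‖S‖ * ‖contractK K φ (pullbackForm (ρ n) ω)‖ := S.le_opNorm _
    _ ≤ ‖S‖ * (ε * (c * (L : ℝ) ^ (k + 1))) := by
        gcongr
        exact norm_contractK_le hφ hε (hs n ω) (by positivity)
          fun z hz => hn z (Metric.cthickening_mono hε₀ K hz)
    _ = ε * (L : ℝ) ^ (k + 1) * ‖S‖ * c := by ring

/-- The limit of the homotopy formula for averaging: on a boundary, the smoothing operator is the
identity up to the boundary of the homotopy chain `G`. -/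
theorem IsSmoothRetraction.tendsto_apply_averageK (hρ : IsSmoothRetraction K ρ L ε₀)
    (hφ : IsMollifier φ ε) {V : Chain K (k + 1)} {Q : Chain K k} (hVQ : V.HasBoundary Q)
    {G : Chain K (k + 1)}
    (hG : ∀ ω : TestForm d (k + 1), Tendsto (fun n => Q (contractK K φ (pullbackForm (ρ n) ω)))
      (hyperfilter ℕ : Filter ℕ) (𝓝 (G (resK K ω)))) (η : TestForm d k) :
    Tendsto (fun n => Q (averageK K φ (pullbackForm (ρ n) η))) (hyperfilter ℕ : Filter ℕ)
      (𝓝 (Q (resK K η) + G (resK K (extDeriv η)))) := by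
  have hle : (hyperfilter ℕ : Filter ℕ) ≤ atTop := Nat.hyperfilter_le_atTop
  have h1 : ∀ n, Q (averageK K φ (pullbackForm (ρ n) η)) = Q (resK K (pullbackForm (ρ n) η)) +
      Q (contractK K φ (pullbackForm (ρ n) (extDeriv η))) := by
    intro n
    rw [hVQ.apply_averageK hφ ((hρ.contDiff n).pullbackForm η.contDiff),
      extDeriv_pullbackForm (hρ.contDiff n) η.contDiff]
  have h2 := hG (TestForm.extDerivCLM d k η)
  rw [TestForm.coe_extDerivCLM] at h2
  obtain ⟨C, hC⟩ := (TestForm.extDerivCLM d k η).hasCompactSupport.exists_bound_of_continuous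
    (TestForm.extDerivCLM d k η).continuous
  rw [TestForm.coe_extDerivCLM] at hC
  simp only [h1]
  exact ((hVQ.tendsto_pullbackForm hρ η.contDiff ((norm_nonneg _).trans (hC 0)) hC).mono_left
    hle).add h2

/-- A boundary that is small on averages is, up to the boundary of a small chain, a chain of small
mass. -/
theorem IsSmoothRetraction.exists_decomposition (hρ : IsSmoothRetraction K ρ L ε₀)
    (hφ : IsMollifier φ ε) (hε : 0 ≤ ε) (hε₀ : ε ≤ ε₀) {Z : Chain K (k + 1)} {S : Chain K k}
    (hZS : Z.HasBoundary S) (hδ : 0 ≤ δ) (hS : IsSmallOnAverages S φ ε ((L : ℝ) ^ k) δ) :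
    ∃ (A : Chain K k) (G : Chain K (k + 1)), G.HasBoundary (A - S) ∧ ‖A‖ ≤ δ ∧
      ‖G‖ ≤ ε * (L : ℝ) ^ (k + 1) * ‖S‖ := by
  obtain ⟨A, hA, hAlim⟩ := hρ.exists_average_limit hφ hε₀ hδ hS
  obtain ⟨G, hG, hGlim⟩ := hρ.exists_contract_limit hφ hε hε₀ S
  refine ⟨A, G, Chain.HasBoundary.of_testForm fun η => ?_, hA, hG⟩
  have h := tendsto_nhds_unique (hAlim η) (hρ.tendsto_apply_averageK hφ hZS hGlim η)
  rw [sub_apply, h]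
  abel

/-- A chain that is small on averages may be replaced by a chain with the same boundary whose mass
is controlled by that of the boundary. -/
theorem IsSmoothRetraction.exists_small_filling (hρ : IsSmoothRetraction K ρ L ε₀)
    (hφ : IsMollifier φ ε) (hε : 0 ≤ ε) (hε₀ : ε ≤ ε₀) {V : Chain K (k + 1)} {Q : Chain K k}
    (hVQ : V.HasBoundary Q) (hδ : 0 ≤ δ)
    (hV : IsSmallOnAverages V φ ε ((L : ℝ) ^ (k + 1)) δ) :
    ∃ W : Chain K (k + 1), W.HasBoundary Q ∧ ‖W‖ ≤ δ + ε * (L : ℝ) ^ (k + 1) * ‖Q‖ := by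
  obtain ⟨A, hA, hAlim⟩ := hρ.exists_average_limit hφ hε₀ hδ hV
  obtain ⟨G, hG, hGlim⟩ := hρ.exists_contract_limit hφ hε hε₀ Q
  refine ⟨A - G, Chain.HasBoundary.of_testForm fun η => ?_,
    (DualC.norm_sub_le A G).trans (add_le_add hA hG)⟩
  have h1 := hAlim (TestForm.extDerivCLM d k η)
  have h2 : ∀ n, V (averageK K φ (pullbackForm (ρ n) (extDeriv η))) =
      Q (averageK K φ (pullbackForm (ρ n) η)) := by
    intro n
    rw [← extDeriv_pullbackForm (hρ.contDiff n) η.contDiff,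
      hVQ.apply_averageK_extDeriv hφ ((hρ.contDiff n).pullbackForm η.contDiff)]
  simp only [TestForm.coe_extDerivCLM, h2] at h1
  have h := tendsto_nhds_unique h1 (hρ.tendsto_apply_averageK hφ hVQ hGlim η)
  rw [sub_apply, h]
  abel

end Decomposition

/-! ### The isoperimetric inequality and small fillings -/

section Isoperimetric

variable {d k : ℕ} {K : Set (Euc d)} [CompactSpace K] {ε₀ : ℝ} {ρ : ℕ → Euc d → Euc d}
  {L : ℝ≥0}

theorem Real.exists_mem_forall_le_two_mul {s : Set ℝ} (hs : s.Nonempty) {m : ℝ} (hm : 0 < m)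
    (h : ∀ a ∈ s, m ≤ a) : ∃ a ∈ s, ∀ b ∈ s, a ≤ 2 * b := by
  have h1 : m ≤ sInf s := le_csInf hs h
  obtain ⟨a, ha, hlt⟩ := exists_lt_of_csInf_lt hs (show sInf s < 2 * sInf s by linarith)
  exact ⟨a, ha, fun b hb => by linarith [csInf_le ⟨m, h⟩ hb]⟩

/-- The linear isoperimetric inequality for boundaries of chains in a Lipschitz neighbourhood
retract. If it failed, there would be almost minimal fillings of unit mass whose boundaries have
mass tending to zero. Subtracting a weak-* limit of these fillings, which is a cycle, and smoothing
produces fillings of mass tending to zero. -/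
theorem IsSmoothRetraction.exists_isoperimetric (hρ : IsSmoothRetraction K ρ L ε₀)
    (hε₀ : 0 < ε₀) (k : ℕ) :
    ∃ C : ℝ, 0 ≤ C ∧ ∀ (V : Chain K (k + 1)) (Q : Chain K k), V.HasBoundary Q →
      ∃ R : Chain K (k + 1), R.HasBoundary Q ∧ ‖R‖ ≤ C * ‖Q‖ := by
  by_contra! hcon
  -- almost minimal fillings of norm one, obtained by rescaling
  have hstep : ∀ n : ℕ, ∃ (R : Chain K (k + 1)) (Q : Chain K k), R.HasBoundary Q ∧ ‖R‖ = 1 ∧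
      ‖Q‖ ≤ 1 / ((n : ℝ) + 1) ∧ ∀ R' : Chain K (k + 1), R'.HasBoundary Q → 1 / 2 ≤ ‖R'‖ := by
    intro n
    obtain ⟨V, Q, hVQ, hbig⟩ := hcon ((n : ℝ) + 1) (by positivity)
    have hQ : 0 < ‖Q‖ := by
      refine DualC.norm_pos ?_
      rintro rfl
      have h0 := hbig 0 fun η _ => rfl
      rw [DualC.norm_zero, DualC.norm_zero, mul_zero] at h0
      exact lt_irrefl _ h0
    obtain ⟨_, ⟨R, hR, rfl⟩, hmin⟩ := Real.exists_mem_forall_le_two_mul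
      (s := {a | ∃ R : Chain K (k + 1), R.HasBoundary Q ∧ ‖R‖ = a}) ⟨_, V, hVQ, rfl⟩
      (m := ((n : ℝ) + 1) * ‖Q‖) (by positivity)
      (by rintro _ ⟨R, hR, rfl⟩; exact (hbig R hR).le)
    have hRpos : 0 < ‖R‖ := lt_of_le_of_lt (by positivity) (hbig R hR)
    have hRinv : 0 ≤ ‖R‖⁻¹ := inv_nonneg.2 hRpos.le
    refine ⟨‖R‖⁻¹ • R, ‖R‖⁻¹ • Q, hR.smul _, ?_, ?_, fun R' hR' => ?_⟩
    · rw [DualC.norm_smul_of_nonneg hRinv, inv_mul_cancel₀ hRpos.ne']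
    · rw [DualC.norm_smul_of_nonneg hRinv, inv_mul_le_iff₀ hRpos, ← div_eq_mul_one_div,
        le_div_iff₀ (by positivity), mul_comm]
      exact (hbig R hR).le
    · have h1 := hR'.smul ‖R‖
      rw [smul_inv_smul₀ hRpos.ne'] at h1
      have h2 := hmin _ ⟨_, h1, rfl⟩
      rw [DualC.norm_smul_of_nonneg hRpos.le] at h2
      nlinarith
  choose R Q hRQ hR hQ hmin using hstep
  have hle : (hyperfilter ℕ : Filter ℕ) ≤ atTop := Nat.hyperfilter_le_atTop
  have hQ0 : Tendsto (fun n => ‖Q n‖) atTop (𝓝 0) :=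
    squeeze_zero (fun _ => DualC.norm_nonneg _) hQ tendsto_one_div_add_atTop_nhds_zero_nat
  obtain ⟨R₀, hR₀, hlim⟩ := DualC.exists_weakLimit hR
  have hR₀b : Chain.HasBoundary R₀ (0 : Chain K k) := by
    intro η hη
    have h1 : Tendsto (fun n => R n (resK K (extDeriv η))) (hyperfilter ℕ : Filter ℕ) (𝓝 0) := by
      simp only [hRQ _ η hη]
      refine squeeze_zero_norm (fun n => (Q n).le_opNorm _) ?_
      simpa using (hQ0.mono_left hle).mul_const ‖resK K η‖
    exact tendsto_nhds_unique (hlim _) h1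
  have hVb : ∀ n, Chain.HasBoundary (R n - R₀) (Q n) := by
    intro n
    simpa using (hRQ n).sub hR₀b
  -- any mollifier will do here: the error term is small because `Q n` is
  obtain ⟨φ, -, hφ⟩ := exists_contDiff_isMollifier d hε₀
  have hsmall := eventually_isSmallOnAverages (V := fun n => R n - R₀) hφ (M := 2)
    (l := (hyperfilter ℕ : Filter ℕ))
    (fun n => (DualC.norm_sub_le _ _).trans (by rw [hR]; linarith))
    (fun Ω _ => by simpa using (hlim (averageK K φ Ω)).sub_const (R₀ (averageK K φ Ω)))
    ((L : ℝ) ^ (k + 1)) (show (0 : ℝ) < 1 / 8 by norm_num)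
  have hQs : ∀ᶠ n in (hyperfilter ℕ : Filter ℕ), ε₀ * (L : ℝ) ^ (k + 1) * ‖Q n‖ < 1 / 8 :=
    ((hQ0.const_mul (ε₀ * (L : ℝ) ^ (k + 1))).mono_left hle).eventually
      (gt_mem_nhds (by norm_num))
  obtain ⟨n, hn1, hn2⟩ := (hsmall.and hQs).exists
  obtain ⟨W, hW, hWn⟩ := hρ.exists_small_filling hφ hε₀.le le_rfl (hVb n) (by norm_num) hn1
  linarith [hmin n W hW]

/-- Boundaries of bounded mass that converge weakly-* to zero have fillings of mass tending to
zero. -/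
theorem IsSmoothRetraction.exists_fillings_tendsto_zero (hρ : IsSmoothRetraction K ρ L ε₀)
    (hε₀ : 0 < ε₀) {S : ℕ → Chain K k} {M : ℝ} (hM : ∀ j, ‖S j‖ ≤ M)
    (hlim : ∀ ω : TestForm d k, Tendsto (fun j => S j (resK K ω)) atTop (𝓝 0))
    (hS : ∀ᶠ j in atTop, ∃ Z : Chain K (k + 1), Z.HasBoundary (S j)) :
    ∃ R : ℕ → Chain K (k + 1), (∀ᶠ j in atTop, (R j).HasBoundary (S j)) ∧
      (∀ j, (R j).HasBoundary (S j) ∨ R j = 0) ∧ Tendsto (fun j => ‖R j‖) atTop (𝓝 0) := by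
  have hM0 : 0 ≤ M := (DualC.norm_nonneg _).trans (hM 0)
  obtain ⟨C, hC0, hC⟩ := hρ.exists_isoperimetric hε₀ k
  have key : ∀ δ > 0, ∀ᶠ j in atTop, ∃ R : Chain K (k + 1), R.HasBoundary (S j) ∧ ‖R‖ ≤ δ := by
    intro δ hδ
    -- the radius makes the homotopy term `ε * D` at most `δ / 2`
    set D := (L : ℝ) ^ (k + 1) * M
    have hD : 0 ≤ D := by positivity
    set ε := min ε₀ (δ / (2 * (D + 1)))
    have hε : 0 < ε := lt_min hε₀ (by positivity)
    obtain ⟨φ, -, hφ⟩ := exists_contDiff_isMollifier d hε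
    have hsmall := eventually_isSmallOnAverages hφ hM
      (fun Ω hΩ => _root_.tendsto_apply_averageK hφ hM hlim hΩ) ((L : ℝ) ^ k)
      (show 0 < δ / (2 * (C + 1)) by positivity)
    filter_upwards [hS, hsmall] with j hj hjs
    obtain ⟨Z, hZ⟩ := hj
    obtain ⟨A, G, hG, hA, hGn⟩ :=
      hρ.exists_decomposition hφ hε.le (min_le_left _ _) hZ (by positivity) hjs
    have hZG : Chain.HasBoundary (Z + G) A := by simpa using hZ.add hG
    obtain ⟨R, hR, hRn⟩ := hC _ _ hZG
    refine ⟨R - G, by simpa using hR.sub hG, (DualC.norm_sub_le R G).trans ?_⟩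
    have h1 : ‖R‖ ≤ δ / 2 := by
      calc ‖R‖ ≤ (C + 1) * (δ / (2 * (C + 1))) :=
            hRn.trans (mul_le_mul (by linarith) hA (DualC.norm_nonneg _) (by positivity))
        _ = δ / 2 := by field_simp
    have h2 : ‖G‖ ≤ δ / 2 := by
      calc ‖G‖ ≤ ε * (L : ℝ) ^ (k + 1) * ‖S j‖ := hGn
        _ ≤ ε * (L : ℝ) ^ (k + 1) * M := by gcongr; exact hM j
        _ = ε * D := by simp only [D]; ring
        _ ≤ δ / (2 * (D + 1)) * (D + 1) := by
            gcongr
            · exact min_le_right _ _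
            · linarith
        _ = δ / 2 := by field_simp
    linarith
  classical
  -- fillings that are minimal up to an error tending to zero
  let s : ℕ → Set ℝ := fun j => {a | ∃ R : Chain K (k + 1), R.HasBoundary (S j) ∧ ‖R‖ = a}
  have hbdd : ∀ j, BddBelow (s j) := fun j =>
    ⟨0, by rintro _ ⟨R, -, rfl⟩; exact DualC.norm_nonneg R⟩
  have hex : ∀ j, ∃ R : Chain K (k + 1), (R.HasBoundary (S j) ∨ R = 0) ∧
      ((s j).Nonempty → R.HasBoundary (S j) ∧ ‖R‖ < sInf (s j) + 1 / ((j : ℝ) + 1)) := by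
    intro j
    by_cases h : (s j).Nonempty
    · obtain ⟨_, ⟨R, hR, rfl⟩, hlt⟩ := exists_lt_of_csInf_lt h
        (show sInf (s j) < sInf (s j) + 1 / ((j : ℝ) + 1) from
          lt_add_of_pos_right _ (by positivity))
      exact ⟨R, .inl hR, fun _ => ⟨hR, hlt⟩⟩
    · exact ⟨0, .inr rfl, fun h' => absurd h' h⟩
  choose R hR1 hR2 using hex
  refine ⟨R, ?_, hR1, ?_⟩
  · filter_upwards [hS] with j ⟨Z, hZ⟩
    exact (hR2 j ⟨_, Z, hZ, rfl⟩).1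
  · rw [Metric.tendsto_nhds]
    intro δ hδ
    have h1 : ∀ᶠ j : ℕ in atTop, 1 / ((j : ℝ) + 1) < δ / 2 :=
      tendsto_one_div_add_atTop_nhds_zero_nat.eventually (gt_mem_nhds (by positivity))
    filter_upwards [key (δ / 2) (by positivity), h1] with j ⟨R', hR', hR'n⟩ hj
    have hmem : ‖R'‖ ∈ s j := ⟨R', hR', rfl⟩
    have h2 := (hR2 j ⟨_, hmem⟩).2
    have h3 := csInf_le (hbdd j) hmem
    rw [dist_zero_right, Real.norm_of_nonneg (DualC.norm_nonneg _)]
    linarith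

end Isoperimetric

/-! ### Currents of finite mass as functionals on continuous forms -/

section Vanishing

open Distribution

variable {d k : ℕ} {T : Current d k}

theorem TestForm.tsupport_mulLeft_subset {χ : Euc d → ℝ} (hχ : ContDiff ℝ (⊤ : ℕ∞) χ)
    (ω : TestForm d k) : tsupport (ω.mulLeft χ hχ) ⊆ tsupport χ ∩ tsupport ω :=
  Set.subset_inter (tsupport_smul_subset_left χ ω) (tsupport_smul_subset_right χ ω)

theorem TestForm.mulLeft_add_mulLeft_one_sub {χ : Euc d → ℝ} (hχ : ContDiff ℝ (⊤ : ℕ∞) χ)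
    (ω : TestForm d k) :
    ω.mulLeft χ hχ + ω.mulLeft (fun x => 1 - χ x) (contDiff_const.sub hχ) = ω := by
  ext1 x
  change χ x • ω x + (1 - χ x) • ω x = ω x
  rw [← add_smul, add_sub_cancel, one_smul]

theorem tsupport_one_sub_subset_compl {χ : Euc d → ℝ} {s : Set (Euc d)}
    (h : ∀ᶠ x in 𝓝ˢ s, χ x = 1) :
    tsupport (fun x => 1 - χ x) ⊆ sᶜ := by
  intro x hx hxs
  refine notMem_tsupport_iff_eventuallyEq.2 ?_ hx
  filter_upwards [nhds_le_nhdsSet hxs h] with y hy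
  simp [hy]

/-- A test form supported in `s ∪ t` is split, by a cutoff function, into forms supported in `s` and
in `t`. -/
theorem Current.IsVanishingOn.union {s t : Set (Euc d)} (hs : IsOpen s) (ht : IsOpen t)
    (hTs : IsVanishingOn T s) (hTt : IsVanishingOn T t) : IsVanishingOn T (s ∪ t) := by
  intro u hu
  have hcl : IsClosed (tsupport u \ t) := (isClosed_tsupport u).sdiff ht
  have hsub : tsupport u \ t ⊆ s := fun x hx => (hu hx.1).resolve_right hx.2
  obtain ⟨v, hv, hv1, hv2⟩ := normal_exists_closure_subset hcl hs hsub
  obtain ⟨χ, hχ, h1, h0, -⟩ := exists_contDiff_cutoff hcl (hv.interior_eq.symm ▸ hv1)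
  have hχv : tsupport χ ⊆ closure v := closure_mono fun x hx => by
    by_contra hxv
    exact hx (h0 x hxv)
  rw [← TestForm.mulLeft_add_mulLeft_one_sub hχ u, map_add, hTs, hTt, add_zero]
  · intro x hx
    have h2 := TestForm.tsupport_mulLeft_subset _ u hx
    by_contra hxt
    exact tsupport_one_sub_subset_compl h1 h2.1 ⟨h2.2, hxt⟩
  · exact (TestForm.tsupport_mulLeft_subset _ u).trans
      (Set.inter_subset_left.trans (hχv.trans hv2))

/-- A current vanishes on the complement of its support. -/
theorem Current.isVanishingOn_compl_support (T : Current d k) : IsVanishingOn T T.supportᶜ := by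
  intro u hu
  obtain ⟨O, -, hO, hTO⟩ : ∃ O, IsOpen O ∧ tsupport u ⊆ O ∧ IsVanishingOn T O := by
    refine u.hasCompactSupport.isCompact.induction_on
      (p := fun s => ∃ O, IsOpen O ∧ s ⊆ O ∧ IsVanishingOn T O) ?_ ?_ ?_ ?_
    · refine ⟨∅, isOpen_empty, subset_rfl, fun v hv => ?_⟩
      have h0 : (v : Euc d → Covector d k) = 0 :=
        tsupport_eq_empty_iff.1 (Set.subset_empty_iff.1 hv)
      have : v = 0 := by
        ext1 x
        exact congrFun h0 x
      rw [this, map_zero]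
    · rintro s t hst ⟨O, hO, htO, hT⟩
      exact ⟨O, hO, hst.trans htO, hT⟩
    · rintro s t ⟨O, hO, hsO, hT⟩ ⟨O', hO', htO', hT'⟩
      exact ⟨O ∪ O', hO.union hO', Set.union_subset_union hsO htO',
        Current.IsVanishingOn.union hO hO' hT hT'⟩
    · intro x hx
      obtain ⟨O, hTO, hO, hxO⟩ := (notMem_dsupport_iff x).1 (hu hx)
      exact ⟨O, mem_nhdsWithin_of_mem_nhds (hO.mem_nhds hxO), O, hO, subset_rfl, hTO⟩
  exact hTO u hO

theorem Current.apply_le_mass_mul (hT : T.mass ≠ ∞) {c : ℝ} (hc : 0 < c) {ω : TestForm d k}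
    (h : ∀ x, ‖ω x‖ ≤ c) : T ω ≤ T.mass.toReal * c := by
  have h1 : ∀ x, ‖(c⁻¹ • ω) x‖ ≤ 1 := fun x => by
    change ‖c⁻¹ • ω x‖ ≤ 1
    rw [norm_smul, Real.norm_of_nonneg (by positivity)]
    exact (inv_mul_le_iff₀ hc).2 (by simpa using h x)
  have h2 : ENNReal.ofReal (T (c⁻¹ • ω)) ≤ T.mass :=
    le_iSup₂ (f := fun (ω : TestForm d k) (_ : ∀ x, ‖ω x‖ ≤ 1) => ENNReal.ofReal (T ω)) _ h1
  have h3 := (ENNReal.ofReal_le_iff_le_toReal hT).1 h2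
  rw [map_smul, smul_eq_mul, inv_mul_le_iff₀ hc] at h3
  linarith

/-- The mass bound involves only the values on `K`: a cutoff near `K` does not change `T ω`, and
makes the comass of `ω` at most `c` everywhere, for any `c` larger than its supremum on `K`. -/
theorem Current.abs_apply_le_mass_mul_norm_resK {K : Set (Euc d)} [CompactSpace K]
    (hT : T.mass ≠ ∞) (hTK : T.support ⊆ K) (ω : TestForm d k) :
    |T ω| ≤ T.mass.toReal * ‖resK K ω‖ := by
  have hK : IsClosed K := (isCompact_iff_compactSpace.2 (inferInstance : CompactSpace K)).isClosed
  have key : ∀ c, ‖resK K ω‖ < c → |T ω| ≤ T.mass.toReal * c := by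
    intro c hc
    have hc0 : 0 < c := (norm_nonneg _).trans_lt hc
    have hU : IsOpen {x | ‖ω x‖ < c} := isOpen_lt ω.continuous.norm continuous_const
    have hKU : K ⊆ interior {x | ‖ω x‖ < c} := hU.interior_eq.symm ▸
      fun x hx => (norm_le_norm_resK ω.continuous hx).trans_lt hc
    obtain ⟨χ, hχ, h1, h0, h01⟩ := exists_contDiff_cutoff hK hKU
    have hT1 : T ω = T (ω.mulLeft χ hχ) := by
      conv_lhs => rw [← TestForm.mulLeft_add_mulLeft_one_sub hχ ω, map_add]
      rw [T.isVanishingOn_compl_support (ω.mulLeft (fun x => 1 - χ x) _), add_zero]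
      exact (TestForm.tsupport_mulLeft_subset _ ω).trans (Set.inter_subset_left.trans
        ((tsupport_one_sub_subset_compl h1).trans (Set.compl_subset_compl.2 hTK)))
    have hb : ∀ x, ‖ω.mulLeft χ hχ x‖ ≤ c := by
      intro x
      change ‖χ x • ω x‖ ≤ c
      rw [norm_smul, Real.norm_of_nonneg (h01 x).1]
      by_cases hx : ‖ω x‖ < c
      · exact (mul_le_of_le_one_left (norm_nonneg _) (h01 x).2).trans hx.le
      · rw [h0 x hx, zero_mul]
        exact hc0.le
    rw [hT1, abs_le']
    refine ⟨Current.apply_le_mass_mul hT hc0 hb, ?_⟩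
    rw [← map_neg]
    refine Current.apply_le_mass_mul hT hc0 fun x => ?_
    change ‖-(ω.mulLeft χ hχ x)‖ ≤ c
    rw [norm_neg]
    exact hb x
  refine ge_of_tendsto (x := 𝓝[>] ‖resK K ω‖) (f := fun c => T.mass.toReal * c) ?_ ?_
  · exact ((continuous_const.mul continuous_id).tendsto _).mono_left nhdsWithin_le_nhds
  · filter_upwards [self_mem_nhdsWithin] with c hc using key c hc

/-- A normal current with support in `K` extends to a functional on the continuous covector fields
on `K`. -/
theorem Current.exists_chain {K : Set (Euc d)} [CompactSpace K] (hT : T ∈ Current.normalIn k K) :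
    ∃ A : Chain K k, ‖A‖ ≤ T.mass.toReal ∧ ∀ ω : TestForm d k, A (resK K ω) = T ω :=
  exists_dualC_of_abs_le (fun ω : TestForm d k => resK K ω)
    (fun ω η => resK_add ω.continuous η.continuous) (fun c ω => resK_smul c ω.continuous)
    (T : TestForm d k →ₗ[ℝ] ℝ) ENNReal.toReal_nonneg
    (T.abs_apply_le_mass_mul_norm_resK
      (ne_top_of_le_ne_top hT.1.1.ne le_self_add) hT.2)

end Vanishing

section ToCurrent

variable {d : ℕ} {K : Set (Euc d)} [CompactSpace K]

/-- The distribution defined by a functional on the continuous functions on `K`. -/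
def DualC.toDistribution {F : Type*} [NormedAddCommGroup F] [NormedSpace ℝ F] (A : DualC K F) :
    TestFunction (⊤ : Opens (Euc d)) F (⊤ : ℕ∞) →L[ℝ] ℝ :=
  (LinearMap.mkContinuous
    { toFun := fun f : BoundedContinuousFunction (Euc d) F => A (resK K f)
      map_add' := fun f g => by rw [← map_add, ← resK_add f.continuous g.continuous]; rfl
      map_smul' := fun c f => by
        rw [RingHom.id_apply, ← map_smul, ← resK_smul c f.continuous]; rfl } ‖A‖
    fun f => (A.le_opNorm _).trans (mul_le_mul_of_nonneg_left
      (norm_resK_le f.continuous (_root_.norm_nonneg f) fun x _ => f.norm_coe_le_norm x)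
      (_root_.norm_nonneg A))) ∘L TestFunction.toBoundedContinuousFunctionCLM ℝ

theorem DualC.toDistribution_apply {F : Type*} [NormedAddCommGroup F] [NormedSpace ℝ F]
    (A : DualC K F) (u : TestFunction (⊤ : Opens (Euc d)) F (⊤ : ℕ∞)) :
    A.toDistribution u = A (resK K u) :=
  rfl

variable {k : ℕ}

/-- The current defined by a chain. -/
def Chain.toCurrent (A : Chain K k) : Current d k :=
  DualC.toDistribution A

theorem Chain.toCurrent_apply (A : Chain K k) (ω : TestForm d k) :
    A.toCurrent ω = A (resK K ω) :=
  DualC.toDistribution_apply A ω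

theorem Chain.mass_toCurrent_le (A : Chain K k) :
    A.toCurrent.mass ≤ ENNReal.ofReal ‖A‖ := by
  refine iSup₂_le fun ω hω => ENNReal.ofReal_le_ofReal ?_
  rw [Chain.toCurrent_apply]
  refine (le_abs_self _).trans ((A.le_opNorm _).trans ?_)
  exact mul_le_of_le_one_right (DualC.norm_nonneg A)
    (norm_resK_le ω.continuous zero_le_one fun x _ => hω x)

theorem Chain.support_toCurrent_subset (A : Chain K k) : A.toCurrent.support ⊆ K := by
  have hK : IsClosed K := (isCompact_iff_compactSpace.2 (inferInstance : CompactSpace K)).isClosed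
  refine Set.sInter_subset_of_mem ⟨fun u hu => ?_, hK⟩
  have h : resK K u = resK K (0 : Euc d → Covector d k) :=
    resK_congr fun x hx => image_eq_zero_of_notMem_tsupport fun hxu => hu hxu hx
  have h0 : resK K (0 : Euc d → Covector d k) = 0 := by
    ext1 x
    exact resK_apply continuous_zero x
  rw [Chain.toCurrent_apply, h, h0, map_zero]

theorem Chain.HasBoundary.boundary_toCurrent {V : Chain K (k + 1)} {Q : Chain K k}
    (h : V.HasBoundary Q) : V.toCurrent.boundary = Q.toCurrent := by
  ext1 ω
  rw [Current.boundary, ContinuousLinearMap.comp_apply, Chain.toCurrent_apply,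
    Chain.toCurrent_apply, TestForm.coe_extDerivCLM]
  exact h ω ω.contDiff

theorem Chain.HasBoundary.toCurrent_mem_normalIn {V : Chain K (k + 1)} {Q : Chain K k}
    (h : V.HasBoundary Q) : V.toCurrent ∈ Current.normalIn (k + 1) K := by
  have hK : IsCompact K := isCompact_iff_compactSpace.2 inferInstance
  refine ⟨⟨ENNReal.add_lt_top.2 ⟨V.mass_toCurrent_le.trans_lt ENNReal.ofReal_lt_top, ?_⟩,
    hK.of_isClosed_subset Distribution.isClosed_dsupport V.support_toCurrent_subset⟩,
    V.support_toCurrent_subset⟩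
  change V.toCurrent.boundary.mass < ∞
  rw [h.boundary_toCurrent]
  exact Q.mass_toCurrent_le.trans_lt ENNReal.ofReal_lt_top

end ToCurrent

end

/-! ### The connectivity theorem -/

theorem mainTheorem6 (d k : ℕ) (K : Set (Euc d)) (hK : IsCompact K)
    (hretr : IsLipschitzNhdRetract K) (M : ℝ) (hM : 0 < M)
    (T : ℕ → Current d k) (hT : ∀ j, T j ∈ Current.normalIn k K)
    (hcycle : ∀ j, (T j).IsBoundaryless) (hmass : ∀ j, (T j).mass ≤ ENNReal.ofReal M)
    (T' : Current d k) (hT' : T' ∈ Current.normalIn k K)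
    (hconv : Current.WeakStarTendsto T T')
    (hbdry : ∀ᶠ j in atTop, T' - T j ∈ Current.normalBoundaries k K) :
    ∃ R : ℕ → Current d (k + 1), (∀ j, R j ∈ Current.normalIn (k + 1) K) ∧
      (∀ᶠ j in atTop, T' - T j = (R j).boundary) ∧
      Tendsto (fun j => (R j).mass) atTop (𝓝 0) := by
  have : CompactSpace K := isCompact_iff_compactSpace.1 hK
  obtain ⟨ρ, L, ε₀, hε₀, hρ⟩ := hretr.exists_isSmoothRetraction hK
  obtain ⟨A', hA'n, hA'⟩ := T'.exists_chain hT'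
  choose A hAn hA using fun j => (T j).exists_chain (hT j)
  have hS : ∀ j (ω : TestForm d k), (A' - A j) (resK K ω) = (T' - T j) ω := fun j ω => by
    rw [sub_apply, sub_apply, hA', hA]
  have hbound : ∀ j, ‖A' - A j‖ ≤ T'.mass.toReal + M := fun j =>
    (DualC.norm_sub_le A' (A j)).trans (add_le_add hA'n
      ((hAn j).trans (ENNReal.toReal_le_of_le_ofReal hM.le (hmass j))))
  have hlim : ∀ ω : TestForm d k,
      Tendsto (fun j => (A' - A j) (resK K ω)) atTop (𝓝 0) := fun ω => by
    simp only [hS, sub_apply]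
    simpa using (hconv ω).const_sub (T' ω)
  have hfill : ∀ᶠ j in atTop, ∃ Z : Chain K (k + 1), Z.HasBoundary (A' - A j) := by
    filter_upwards [hbdry] with j ⟨Z, hZ, hZb⟩
    obtain ⟨B, -, hB⟩ := Z.exists_chain hZ
    refine ⟨B, Chain.HasBoundary.of_testForm fun η => ?_⟩
    rw [hS, hZb, ← TestForm.coe_extDerivCLM, hB]
    rfl
  obtain ⟨R, hR, hR', hRlim⟩ := hρ.exists_fillings_tendsto_zero hε₀ hbound hlim hfill
  refine ⟨fun j => (R j).toCurrent, fun j => ?_, ?_, ?_⟩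
  · obtain h | h := hR' j
    · exact h.toCurrent_mem_normalIn
    -- `R j = 0`, which fills the zero chain
    · have h0 : (R j).HasBoundary 0 := h ▸ fun _ _ => rfl
      exact h0.toCurrent_mem_normalIn
  · filter_upwards [hR] with j hj
    rw [hj.boundary_toCurrent]
    ext1 ω
    rw [Chain.toCurrent_apply, hS]
  · refine tendsto_of_tendsto_of_tendsto_of_le_of_le tendsto_const_nhds ?_ (fun _ => zero_le)
      fun j => (R j).mass_toCurrent_le
    simpa using ENNReal.tendsto_ofReal hRlim
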